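/- Let $d\in\{1,2,3\}$, let $\mathcal D\subset\mathbb R^d$ be a bounded domain (a non-empty, open, connected, bounded set) and let $N>0$. Let $H^1_0(\mathcal D)=H^1_0(\mathcal D;\mathbb C)$ be the closure of $C_c^\infty(\mathcal D;\mathbb C)$ in the Sobolev space $H^1(\mathcal D;\mathbb C)$, and for $\varPhi\in H^1_0(\mathcal D)$ put $$E(\varPhi)=\frac12\int_{\mathcal D}|\nabla\varPhi|^2\,dx-\frac14\int_{\mathcal D}|\varPhi|^4\,dx+\frac16\int_{\mathcal D}|\varPhi|^6\,dx,$$ $$e(\mathcal D,N)=\inf\Big\{E(\varPhi):\ \varPhi\in H^1_0(\mathcal D),\ \int_{\mathcal D}|\varPhi|^2\,dx=N\Big\}.$$ A ground state for $e(\mathcal D,N)$ is a function $\varPhi\in H^1_0(\mathcal D)$ with $\int_{\mathcal D}|\varPhi|^2\,dx=N$ and $E(\varPhi)=e(\mathcal D,N)$, where $e(\mathcal D,N)>-\infty$. Then there exists at least one (real-valued) non-negative ground state for $e(\mathcal D,N)$. Moreover, if $\mathcal D=B(0,R)$ is an open ball centred at the origin with $R>0$, then there exists at least one non-negative ground state $u$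 for $e(\mathcal D,N)$ that is radially symmetric and decreasing, i.e. it has a representative with $u(x)=u(y)$ whenever $x,y\in\mathcal D$, $|x|=|y|$, and $u(x)\ge u(y)$ whenever $x,y\in\mathcal D$, $0<|x|\le|y|$. -/

import Mathlib

open MeasureTheory Filter Topology Set
open scoped ContDiff ENNReal

noncomputable section

namespace CubicQuintic

/-- Complex-valued test functions on `D`, that is, elements of `C_c^∞(D; ℂ)`, extended by zero. -/
def IsTestFunction {d : ℕ} (D : Set (EuclideanSpace ℝ (Fin d)))
    (φ : EuclideanSpace ℝ (Fin d) → ℂ) : Prop :=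
  ContDiff ℝ ∞ φ ∧ HasCompactSupport φ ∧ tsupport φ ⊆ D

/-- The classical gradient `(∂₁φ, …, ∂_dφ)` of a differentiable complex-valued function. -/
def classicalGradient {d : ℕ} (φ : EuclideanSpace ℝ (Fin d) → ℂ)
    (x : EuclideanSpace ℝ (Fin d)) : EuclideanSpace ℂ (Fin d) :=
  WithLp.toLp 2 (fun i => fderiv ℝ φ x (EuclideanSpace.single i (1 : ℝ)))

/-- `G` is a weak gradient of `u` in the open set `D`:
`∫_D u ∂ᵢφ = - ∫_D Gᵢ φ` for all test functions `φ` on `D` and all `i`. -/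
def IsWeakGradient {d : ℕ} (D : Set (EuclideanSpace ℝ (Fin d)))
    (u : EuclideanSpace ℝ (Fin d) → ℂ)
    (G : EuclideanSpace ℝ (Fin d) → EuclideanSpace ℂ (Fin d)) : Prop :=
  LocallyIntegrableOn u D volume ∧ LocallyIntegrableOn G D volume ∧
    ∀ φ : EuclideanSpace ℝ (Fin d) → ℂ, IsTestFunction D φ → ∀ i : Fin d,
      ∫ x in D, u x * classicalGradient φ x i = - ∫ x in D, G x i * φ x

open Classical in
/-- The weak gradient of `u` in `D` (unique up to null sets when it exists; `0` otherwise). -/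
def weakGradient {d : ℕ} (D : Set (EuclideanSpace ℝ (Fin d)))
    (u : EuclideanSpace ℝ (Fin d) → ℂ) :
    EuclideanSpace ℝ (Fin d) → EuclideanSpace ℂ (Fin d) :=
  if h : ∃ G, IsWeakGradient D u G then h.choose else 0

/-- (Representatives of) the Sobolev space `H¹(D; ℂ)`: functions in `L²(D)` that have a weak
gradient in `L²(D)`. Only the values on `D` matter. -/
def H1 {d : ℕ} (D : Set (EuclideanSpace ℝ (Fin d))) : Set (EuclideanSpace ℝ (Fin d) → ℂ) :=
  {u | MemLp u 2 (volume.restrict D) ∧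
    ∃ G, IsWeakGradient D u G ∧ MemLp G 2 (volume.restrict D)}

/-- (Representatives of) `H¹₀(D; ℂ)`: the closure of the test functions in `H¹(D; ℂ)`. -/
def H10 {d : ℕ} (D : Set (EuclideanSpace ℝ (Fin d))) : Set (EuclideanSpace ℝ (Fin d) → ℂ) :=
  {u | u ∈ H1 D ∧ ∃ φ : ℕ → EuclideanSpace ℝ (Fin d) → ℂ,
    (∀ n, IsTestFunction D (φ n)) ∧
    Tendsto (fun n => eLpNorm (fun x => φ n x - u x) 2 (volume.restrict D)) atTop (𝓝 0) ∧
    Tendsto (fun n => eLpNorm (fun x => classicalGradient (φ n) x - weakGradient D u x) 2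
      (volume.restrict D)) atTop (𝓝 0)}

/-- The energy `E(Φ) = ½ ∫_D |∇Φ|² - ¼ ∫_D |Φ|⁴ + ⅙ ∫_D |Φ|⁶`. -/
def energy {d : ℕ} (D : Set (EuclideanSpace ℝ (Fin d)))
    (Φ : EuclideanSpace ℝ (Fin d) → ℂ) : ℝ :=
  (1 / 2) * (∫ x in D, ‖weakGradient D Φ x‖ ^ 2)
    - (1 / 4) * (∫ x in D, ‖Φ x‖ ^ 4)
    + (1 / 6) * (∫ x in D, ‖Φ x‖ ^ 6)

/-- The admissible class `{Φ ∈ H¹₀(D; ℂ) : ∫_D |Φ|² = N}`. -/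
def admissible {d : ℕ} (D : Set (EuclideanSpace ℝ (Fin d))) (N : ℝ) :
    Set (EuclideanSpace ℝ (Fin d) → ℂ) :=
  {Φ | Φ ∈ H10 D ∧ ∫ x in D, ‖Φ x‖ ^ 2 = N}

/-- The ground state energy `e(D, N) = inf {E(Φ) : Φ ∈ H¹₀(D), ∫_D |Φ|² = N}`. -/
def groundStateEnergy {d : ℕ} (D : Set (EuclideanSpace ℝ (Fin d))) (N : ℝ) : ℝ :=
  sInf (energy D '' admissible D N)

/-- A ground state of `e(D, N)`: an admissible function that attains the infimum. The last clause
says that `e(D, N)` really is a lower bound (`sInf` of an unbounded set of reals would be `0`). -/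
def IsGroundState {d : ℕ} (D : Set (EuclideanSpace ℝ (Fin d))) (N : ℝ)
    (Φ : EuclideanSpace ℝ (Fin d) → ℂ) : Prop :=
  Φ ∈ admissible D N ∧ energy D Φ = groundStateEnergy D N ∧
    ∀ Ψ ∈ admissible D N, groundStateEnergy D N ≤ energy D Ψ

/-- `u` is radially symmetric on `D` and decreasing (in the sense of symmetric-decreasing functions,
that is, non-increasing) with respect to `|x|`. A function such as `|x|^(-1/4)` counts as radially
decreasing, so its value at the single point `0` is not constrained. -/
def IsRadialDecreasingOn {d : ℕ} (D : Set (EuclideanSpace ℝ (Fin d)))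
    (u : EuclideanSpace ℝ (Fin d) → ℝ) : Prop :=
  (∀ x ∈ D, ∀ y ∈ D, ‖x‖ = ‖y‖ → u x = u y) ∧
    ∀ x ∈ D, ∀ y ∈ D, 0 < ‖x‖ → ‖x‖ ≤ ‖y‖ → u y ≤ u x

end CubicQuintic

end

/-!
The ground states are found by the direct method in `L²`, applied to non-negative functions
only.

*Relaxation.* For a real function `u` on the whole space, `GradNormLE D u C` says that `u` is an
`L²` limit of test functions on `D` with gradient norm at most `C`, up to small errors, and
`gradNorm D u` is the best such `C`. Among functions in `L²`, it is finite exactly on `H¹₀(D)`,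
where it is the norm of the weak gradient. The halves of this statement that are needed are
`gradNormLE_norm`, which also replaces a complex function by its modulus (through the smooth
functions `√(|φ|² + ε²) - ε`), and `mem_H10_of_gradNormLE`, where the parallelogram law upgrades
bounded gradients to strongly convergent ones. Completing the square,
`t⁶/6 - t⁴/4 = (t²/6)(t² - 3/4)² - (3/32) t²`, turns the energy at fixed mass into a sum of
non-negative terms, `relaxedEnergy`, up to a constant. The Sobolev embedding into `L⁶` (this is where `d ≤ 3`
enters) guarantees that the integrals in the energy are finite on `H¹₀(D)`.

*Existence.* The relaxed energy is lower semicontinuous on `L²`, by construction and by Fatou's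
lemma, and its sublevel sets at fixed mass are compact by Rellich's theorem. The latter is
proved by comparing test functions with their averages over small balls, which turn weak into
strong convergence. So minimizers exist, and the set of minimizers is compact
(`exists_minimizer`).

*Radial symmetry.* On a centred ball, no rearrangement inequality is needed: among all
non-negative minimizers choose one that maximizes the integral against a strictly radially
decreasing weight. Polarization with respect to a mirror not containing the origin, that is,
moving the larger of the values at two mirror points to the side of the origin, does not
increase the relaxed energy (`relaxedEnergy_polarize_le`) and increases the weighted integral,
strictly unless nothing is moved. Hence the chosen minimizer `u` satisfies `u (σ x) ≤ u x` on
the side of the origin, for every such mirror `σ` (`reflect_le_of_integral_le`). The averages of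
`u` over balls inherit this property everywhere, so they are radially decreasing, and the limit
over shrinking balls is the required representative (`exists_radial_representative`).
-/

noncomputable section

namespace CubicQuintic

/-! ### A substitute for weak compactness -/

section Hilbert

/-- A version of Mazur's lemma: if `x` can be approximated by values of `S` at points where `T` is
almost bounded by `C`, the approximating points can be chosen such that their images under `T` converge in norm, to a limit of norm at most `C`. -/
theorem exists_seq_tendsto_of_norm_le {𝕜 V X Y : Type*} [RCLike 𝕜] [AddCommGroup V] [Module ℝ V]
    [NormedAddCommGroup X] [NormedSpace ℝ X] [NormedAddCommGroup Y] [NormedSpace ℝ Y]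
    [InnerProductSpace 𝕜 Y] [CompleteSpace Y] (S : V →ₗ[ℝ] X) (T : V →ₗ[ℝ] Y) (x : X) {C : ℝ}
    (hC : 0 ≤ C) (h : ∀ ε : ℝ, 0 < ε → ∃ v, ‖S v - x‖ ≤ ε ∧ ‖T v‖ ≤ C + ε) :
    ∃ (v : ℕ → V) (y : Y), Tendsto (fun n => S (v n)) atTop (𝓝 x) ∧
      Tendsto (fun n => T (v n)) atTop (𝓝 y) ∧ ‖y‖ ≤ C := by
  -- `m ε` is the least energy at distance `ε` from `x`; near-minimizers are Cauchy by the
  -- parallelogram law, since the midpoint of two competitors is a competitor.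
  let A : ℝ → Set ℝ := fun ε => (fun v => ‖T v‖ ^ 2) '' {v | ‖S v - x‖ ≤ ε}
  let m : ℝ → ℝ := fun ε => sInf (A ε)
  have hbdd : ∀ ε, BddBelow (A ε) := fun ε => ⟨0, by rintro _ ⟨v, -, rfl⟩; positivity⟩
  have hne : ∀ ε, 0 < ε → (A ε).Nonempty := fun ε hε => by
    obtain ⟨v, hv, -⟩ := h ε hε
    exact ⟨_, v, hv, rfl⟩
  have hmle : ∀ ε v, ‖S v - x‖ ≤ ε → m ε ≤ ‖T v‖ ^ 2 := fun ε v hv => csInf_le (hbdd ε) ⟨v, hv, rfl⟩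
  have hmC : ∀ ε, 0 < ε → m ε ≤ C ^ 2 := by
    intro ε hε
    have hlim : Tendsto (fun δ : ℝ => (C + δ) ^ 2) (𝓝[>] 0) (𝓝 (C ^ 2)) := by
      have : Tendsto (fun δ : ℝ => (C + δ) ^ 2) (𝓝 0) (𝓝 ((C + 0) ^ 2)) :=
        (Continuous.tendsto (by fun_prop) 0)
      rw [add_zero] at this
      exact this.mono_left nhdsWithin_le_nhds
    refine ge_of_tendsto hlim ?_
    filter_upwards [Ioo_mem_nhdsGT hε] with δ hδ
    obtain ⟨v, hv, hv'⟩ := h δ hδ.1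
    refine (hmle ε v (hv.trans hδ.2.le)).trans ?_
    gcongr
  let e : ℕ → ℝ := fun n => 1 / ((n : ℝ) + 1)
  have he : ∀ n, 0 < e n := fun n => by positivity
  have he0 : Tendsto e atTop (𝓝 0) := tendsto_one_div_add_atTop_nhds_zero_nat
  have hem : Antitone e := fun a b hab => one_div_le_one_div_of_le (by positivity) (by gcongr)
  let a : ℕ → ℝ := fun n => m (e n)
  have ham : Monotone a := by
    intro i j hij
    refine csInf_le_csInf (hbdd _) (hne _ (he j)) (image_mono ?_)
    intro v hv
    exact le_trans hv (hem hij)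
  have hab : BddAbove (range a) := ⟨C ^ 2, by rintro _ ⟨n, rfl⟩; exact hmC _ (he n)⟩
  set L := ⨆ n, a n with hL
  have haL : Tendsto a atTop (𝓝 L) := tendsto_atTop_ciSup ham hab
  have hle : ∀ n, a n ≤ L := fun n => le_ciSup hab n
  have hLC : L ≤ C ^ 2 := ciSup_le fun n => hmC _ (he n)
  have hex : ∀ n, ∃ v, ‖S v - x‖ ≤ e n ∧ ‖T v‖ ^ 2 < a n + e n := by
    intro n
    obtain ⟨_, ⟨v, hv, rfl⟩, hv'⟩ :=
      exists_lt_of_csInf_lt (hne _ (he n)) (lt_add_of_pos_right (m (e n)) (he n))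
    exact ⟨v, hv, hv'⟩
  choose v hv hv' using hex
  have hcau : CauchySeq fun n => T (v n) := by
    refine cauchySeq_of_le_tendsto_0' (fun K => √(4 * (L - a K) + 4 * e K)) ?_ ?_
    · intro K n hKn
      rw [dist_eq_norm]
      refine Real.le_sqrt_of_sq_le ?_
      have h1 := parallelogram_law_with_norm 𝕜 (T (v K)) (T (v n))
      have h2 := hmle (e K) ((1 / 2 : ℝ) • (v K + v n)) (by
        have : S ((1 / 2 : ℝ) • (v K + v n)) - x =
            (1 / 2 : ℝ) • (S (v K) - x) + (1 / 2 : ℝ) • (S (v n) - x) := by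
          simp only [map_smul, map_add]
          module
        rw [this]
        refine (norm_add_le _ _).trans ?_
        rw [norm_smul, norm_smul]
        have := hv K
        have := (hv n).trans (hem hKn)
        norm_num
        linarith)
      rw [map_smul, map_add, norm_smul, mul_pow] at h2
      norm_num at h2
      have := hv' K
      have := hv' n
      have := hle n
      have := hle K
      have := hem hKn
      change a K ≤ _ at h2
      nlinarith
    · have : Tendsto (fun K => √(4 * (L - a K) + 4 * e K)) atTop (𝓝 (√(4 * (L - L) + 4 * 0))) :=
        ((((tendsto_const_nhds.sub haL).const_mul 4).add (he0.const_mul 4))).sqrt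
      simpa using this
  obtain ⟨y, hy⟩ := cauchySeq_tendsto_of_complete hcau
  refine ⟨v, y, ?_, hy, ?_⟩
  · rw [tendsto_iff_norm_sub_tendsto_zero]
    exact squeeze_zero (fun _ => norm_nonneg _) hv he0
  · have h1 : Tendsto (fun n => ‖T (v n)‖ ^ 2) atTop (𝓝 (‖y‖ ^ 2)) := hy.norm.pow 2
    have h2 : Tendsto (fun n => a n + e n) atTop (𝓝 (L + 0)) := haL.add he0
    have h3 := le_of_tendsto_of_tendsto' h1 h2 fun n => (hv' n).le
    exact abs_le_of_sq_le_sq' (by linarith) hC |>.2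

end Hilbert

/-! ### Real test functions and approximate gradient bounds -/

/-- Real-valued test functions on `D`: smooth functions with compact support inside `D`. -/
def realTest {d : ℕ} (D : Set (EuclideanSpace ℝ (Fin d))) :
    Submodule ℝ (EuclideanSpace ℝ (Fin d) → ℝ) where
  carrier := {f | ContDiff ℝ ∞ f ∧ HasCompactSupport f ∧ tsupport f ⊆ D}
  add_mem' := by
    rintro f g ⟨hf, hf', hf''⟩ ⟨hg, hg', hg''⟩
    exact ⟨hf.add hg, hf'.add hg', (tsupport_add f g).trans (union_subset hf'' hg'')⟩
  zero_mem' := ⟨contDiff_const, HasCompactSupport.zero, by simp [tsupport]⟩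
  smul_mem' := by
    rintro c f ⟨hf, hf', hf''⟩
    refine ⟨contDiff_const.smul hf, hf'.smul_left (f := fun _ => c), ?_⟩
    exact (closure_mono (Function.support_const_smul_subset c f)).trans hf''

section RealTest

variable {d : ℕ} {D : Set (EuclideanSpace ℝ (Fin d))} {f : EuclideanSpace ℝ (Fin d) → ℝ}

theorem realTest.continuous (hf : f ∈ realTest D) : Continuous f := hf.1.continuous

theorem realTest.differentiable (hf : f ∈ realTest D) : Differentiable ℝ f :=
  hf.1.differentiable (by simp)

theorem realTest.continuous_fderiv (hf : f ∈ realTest D) : Continuous (fderiv ℝ f) :=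
  hf.1.continuous_fderiv (by simp)

theorem realTest.hasCompactSupport (hf : f ∈ realTest D) : HasCompactSupport f := hf.2.1

theorem realTest.eq_zero (hf : f ∈ realTest D) {x : EuclideanSpace ℝ (Fin d)} (hx : x ∉ D) :
    f x = 0 :=
  image_eq_zero_of_notMem_tsupport fun h => hx (hf.2.2 h)

theorem realTest.memLp (hf : f ∈ realTest D) (p : ℝ≥0∞) : MemLp f p volume :=
  (realTest.continuous hf).memLp_of_hasCompactSupport (realTest.hasCompactSupport hf)

theorem realTest.memLp_fderiv (hf : f ∈ realTest D) (p : ℝ≥0∞) : MemLp (fderiv ℝ f) p volume :=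
  (realTest.continuous_fderiv hf).memLp_of_hasCompactSupport
    ((realTest.hasCompactSupport hf).fderiv (𝕜 := ℝ))

end RealTest

/-- `GradNormLE D u C` says that `u` is a limit in `L²` of test functions on `D` whose gradients
have `L²` norm at most `C`, up to an arbitrarily small error. For finite `C` it expresses that `u`,
extended by zero, lies in `H¹₀(D)` and that its gradient has `L²` norm at most `C`. -/
def GradNormLE {d : ℕ} (D : Set (EuclideanSpace ℝ (Fin d)))
    (u : EuclideanSpace ℝ (Fin d) → ℝ) (C : ℝ≥0∞) : Prop :=
  ∀ ε : ℝ≥0∞, ε ≠ 0 → ∃ f ∈ realTest D, eLpNorm (fun x => f x - u x) 2 volume ≤ ε ∧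
    eLpNorm (fderiv ℝ f) 2 volume ≤ C + ε

/-! ### Compactness in `L²` -/

section Rellich

theorem sq_lintegral_le_lintegral_sq {α : Type*} [MeasurableSpace α] (ν : Measure α)
    [IsProbabilityMeasure ν] {g : α → ℝ≥0∞} (hg : AEMeasurable g ν) :
    (∫⁻ a, g a ∂ν) ^ 2 ≤ ∫⁻ a, g a ^ 2 ∂ν := by
  have h := ENNReal.lintegral_mul_le_Lp_mul_Lq ν (Real.HolderConjugate.two_two) hg
    (aemeasurable_const (b := (1 : ℝ≥0∞)))
  simp only [Pi.mul_apply, mul_one, ENNReal.one_rpow, lintegral_const, measure_univ] at h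
  have h2 : (∫⁻ a, g a ∂ν) ^ 2 ≤ ((∫⁻ a, g a ^ (2 : ℝ) ∂ν) ^ (1 / (2 : ℝ))) ^ 2 := by gcongr
  refine h2.trans_eq ?_
  rw [← ENNReal.rpow_natCast, ← ENNReal.rpow_mul]
  simp

theorem eLpNorm_two_sq {α F : Type*} [MeasurableSpace α] [NormedAddCommGroup F] (g : α → F)
    (ν : Measure α) : eLpNorm g 2 ν ^ 2 = ∫⁻ a, ‖g a‖ₑ ^ 2 ∂ν := by
  have := eLpNorm_nnreal_pow_eq_lintegral (μ := ν) (f := g) (p := 2) (by norm_num)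
  simpa using this

variable {d : ℕ} {D : Set (EuclideanSpace ℝ (Fin d))}

/-- Translating a test function by `h` changes it in `L²` by at most `‖h‖ ‖∇f‖`. -/
theorem lintegral_translate_sub_sq_le {f : EuclideanSpace ℝ (Fin d) → ℝ} (hf : ContDiff ℝ 1 f)
    (h : EuclideanSpace ℝ (Fin d)) :
    ∫⁻ x, ‖f x - f (x + h)‖ₑ ^ 2 ≤ ‖h‖ₑ ^ 2 * ∫⁻ x, ‖fderiv ℝ f x‖ₑ ^ 2 := by
  have hcd : Continuous (fderiv ℝ f) := hf.continuous_fderiv (by simp)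
  let ν : Measure ℝ := volume.restrict (Ioc 0 1)
  have : IsProbabilityMeasure ν := ⟨by simp [ν]⟩
  have key : ∀ x, ‖f x - f (x + h)‖ₑ ^ 2 ≤
      ∫⁻ t, (‖fderiv ℝ f (x + t • h)‖ₑ * ‖h‖ₑ) ^ 2 ∂ν := by
    intro x
    have hder : ∀ t ∈ uIcc (0 : ℝ) 1,
        HasDerivAt (fun t : ℝ => f (x + t • h)) (fderiv ℝ f (x + t • h) h) t := by
      intro t _
      have h1 : HasDerivAt (fun t : ℝ => x + t • h) h t := by
        simpa using ((hasDerivAt_id t).smul_const h).const_add x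
      exact ((hf.differentiable (by simp)) (x + t • h)).hasFDerivAt.comp_hasDerivAt t h1
    have hint := intervalIntegral.integral_eq_sub_of_hasDerivAt hder
      (Continuous.intervalIntegrable (by fun_prop) _ _)
    simp only [one_smul, zero_smul, add_zero] at hint
    have h2 : ‖f x - f (x + h)‖ₑ ≤ ∫⁻ t, ‖fderiv ℝ f (x + t • h)‖ₑ * ‖h‖ₑ ∂ν := by
      rw [← enorm_neg, neg_sub, ← hint, intervalIntegral.integral_of_le zero_le_one]
      refine (enorm_integral_le_lintegral_enorm _).trans (lintegral_mono fun t => ?_)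
      exact ContinuousLinearMap.le_opENorm _ _
    refine (by gcongr : _ ≤ (∫⁻ t, ‖fderiv ℝ f (x + t • h)‖ₑ * ‖h‖ₑ ∂ν) ^ 2).trans ?_
    refine sq_lintegral_le_lintegral_sq ν ?_
    exact (Continuous.measurable (by fun_prop)).aemeasurable.mul_const _
  have hmeas : Measurable (Function.uncurry fun (x : EuclideanSpace ℝ (Fin d)) (t : ℝ) =>
      (‖fderiv ℝ f (x + t • h)‖ₑ * ‖h‖ₑ) ^ 2) := by
    refine Measurable.pow_const (Measurable.mul_const (Continuous.measurable ?_) _) 2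
    fun_prop
  calc ∫⁻ x, ‖f x - f (x + h)‖ₑ ^ 2
      ≤ ∫⁻ x, ∫⁻ t, (‖fderiv ℝ f (x + t • h)‖ₑ * ‖h‖ₑ) ^ 2 ∂ν := lintegral_mono key
    _ = ∫⁻ t, ∫⁻ x, (‖fderiv ℝ f (x + t • h)‖ₑ * ‖h‖ₑ) ^ 2 ∂volume ∂ν :=
        lintegral_lintegral_swap hmeas.aemeasurable
    _ = ∫⁻ _, (‖h‖ₑ ^ 2 * ∫⁻ x, ‖fderiv ℝ f x‖ₑ ^ 2) ∂ν := by
        refine lintegral_congr fun t => ?_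
        rw [lintegral_add_right_eq_self (fun x => (‖fderiv ℝ f x‖ₑ * ‖h‖ₑ) ^ 2) (t • h)]
        simp_rw [mul_pow, mul_comm _ (‖h‖ₑ ^ 2)]
        exact lintegral_const_mul' _ _ (by simp)
    _ = ‖h‖ₑ ^ 2 * ∫⁻ x, ‖fderiv ℝ f x‖ₑ ^ 2 := by simp

/-- The average of `f` over the ball of radius `δ` around `x`. -/
def ballAverage (δ : ℝ) (f : EuclideanSpace ℝ (Fin d) → ℝ) (x : EuclideanSpace ℝ (Fin d)) : ℝ :=
  ⨍ y in Metric.ball x δ, f y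

theorem ballAverage_eq (δ : ℝ) (f : EuclideanSpace ℝ (Fin d) → ℝ)
    (x : EuclideanSpace ℝ (Fin d)) :
    ballAverage δ f x = ⨍ h in Metric.ball 0 δ, f (x + h) := by
  have hmp := measurePreserving_add_left (volume : Measure (EuclideanSpace ℝ (Fin d))) x
  have hpre : (fun h => x + h) ⁻¹' Metric.ball x δ = Metric.ball 0 δ := by
    ext h; simp [Metric.mem_ball, dist_eq_norm]
  rw [ballAverage, setAverage_eq, setAverage_eq]
  congr 1
  · rw [Measure.real, Measure.real, ← hpre, hmp.measure_preimage_emb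
      (MeasurableEquiv.addLeft x).measurableEmbedding]
  · rw [← hpre]
    exact (hmp.setIntegral_preimage_emb (MeasurableEquiv.addLeft x).measurableEmbedding f _).symm

theorem lintegral_sub_ballAverage_sq_le {f : EuclideanSpace ℝ (Fin d) → ℝ} (hf : ContDiff ℝ 1 f)
    {δ : ℝ} (hδ : 0 < δ) :
    ∫⁻ x, ‖f x - ballAverage δ f x‖ₑ ^ 2 ≤
      ENNReal.ofReal δ ^ 2 * ∫⁻ x, ‖fderiv ℝ f x‖ₑ ^ 2 := by
  let B : Set (EuclideanSpace ℝ (Fin d)) := Metric.ball 0 δ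
  let ν : Measure (EuclideanSpace ℝ (Fin d)) := (volume B)⁻¹ • volume.restrict B
  have hB0 : volume B ≠ 0 := (Metric.measure_ball_pos volume _ hδ).ne'
  have hB1 : volume B ≠ ⊤ := Metric.isBounded_ball.measure_lt_top.ne
  have : IsProbabilityMeasure ν := ⟨by simp [ν, ENNReal.inv_mul_cancel hB0 hB1]⟩
  have hν : ∀ᵐ h ∂ν, h ∈ B :=
    Measure.smul_absolutelyContinuous.ae_le (ae_restrict_mem Metric.isOpen_ball.measurableSet)
  have hcont : Continuous f := hf.continuous
  have key : ∀ x, ‖f x - ballAverage δ f x‖ₑ ^ 2 ≤ ∫⁻ h, ‖f x - f (x + h)‖ₑ ^ 2 ∂ν := by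
    intro x
    have hav : ballAverage δ f x = ∫ h, f (x + h) ∂ν := by
      rw [ballAverage_eq, average]
      simp [ν, B]
    have hint : Integrable (fun h => f (x + h)) ν := by
      refine Integrable.smul_measure ?_ (by simpa using hB0)
      exact ((by fun_prop : Continuous fun h => f (x + h)).continuousOn.integrableOn_compact
        (isCompact_closedBall 0 δ)).mono_set Metric.ball_subset_closedBall
    have : f x - ballAverage δ f x = ∫ h, (f x - f (x + h)) ∂ν := by
      rw [integral_sub (integrable_const _) hint, hav]
      simp
    rw [this]
    have h2 := enorm_integral_le_lintegral_enorm (μ := ν) (fun h => f x - f (x + h))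
    refine (by gcongr : _ ≤ (∫⁻ h, ‖f x - f (x + h)‖ₑ ∂ν) ^ 2).trans ?_
    exact sq_lintegral_le_lintegral_sq ν (Continuous.measurable (by fun_prop)).aemeasurable
  have hmeas : Measurable (Function.uncurry fun (x h : EuclideanSpace ℝ (Fin d)) =>
      ‖f x - f (x + h)‖ₑ ^ 2) := by
    refine Measurable.pow_const (Continuous.measurable ?_) 2
    fun_prop
  calc ∫⁻ x, ‖f x - ballAverage δ f x‖ₑ ^ 2
      ≤ ∫⁻ x, ∫⁻ h, ‖f x - f (x + h)‖ₑ ^ 2 ∂ν := lintegral_mono key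
    _ = ∫⁻ h, ∫⁻ x, ‖f x - f (x + h)‖ₑ ^ 2 ∂volume ∂ν := lintegral_lintegral_swap hmeas.aemeasurable
    _ ≤ ∫⁻ _, (ENNReal.ofReal δ ^ 2 * ∫⁻ x, ‖fderiv ℝ f x‖ₑ ^ 2) ∂ν := by
        refine lintegral_mono_ae ?_
        filter_upwards [hν] with h hh
        refine (lintegral_translate_sub_sq_le hf h).trans ?_
        gcongr
        rw [← ofReal_norm]
        exact ENNReal.ofReal_le_ofReal (by simpa [B] using (mem_ball_zero_iff.1 hh).le)
    _ = ENNReal.ofReal δ ^ 2 * ∫⁻ x, ‖fderiv ℝ f x‖ₑ ^ 2 := by simp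

theorem eLpNorm_sub_ballAverage_le {f : EuclideanSpace ℝ (Fin d) → ℝ} (hf : ContDiff ℝ 1 f)
    {δ : ℝ} (hδ : 0 < δ) :
    eLpNorm (fun x => f x - ballAverage δ f x) 2 volume ≤
      ENNReal.ofReal δ * eLpNorm (fderiv ℝ f) 2 volume := by
  rw [← ENNReal.pow_le_pow_left_iff two_ne_zero, mul_pow, eLpNorm_two_sq, eLpNorm_two_sq]
  exact lintegral_sub_ballAverage_sq_le hf hδ

theorem measurable_ballAverage {f : EuclideanSpace ℝ (Fin d) → ℝ} (hf : Continuous f) (δ : ℝ) :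
    Measurable (ballAverage δ f) := by
  have h1 : ballAverage δ f = fun x => ⨍ h in Metric.ball 0 δ, f (x + h) :=
    funext (ballAverage_eq δ f)
  rw [h1]
  simp only [setAverage_eq, smul_eq_mul]
  refine Measurable.const_mul ?_ _
  have : StronglyMeasurable (Function.uncurry fun (x h : EuclideanSpace ℝ (Fin d)) => f (x + h)) :=
    Continuous.stronglyMeasurable (by fun_prop)
  exact this.integral_prod_right.measurable

/-- For a bounded weakly convergent sequence in `L²`, the averages over balls of a fixed radius
converge pointwise and are uniformly bounded. For test functions on a bounded domain they hence
converge in `L²`, by dominated convergence. -/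
theorem exists_tendsto_ballAverage (hD : Bornology.IsBounded D)
    {f : ℕ → EuclideanSpace ℝ (Fin d) → ℝ} (hf : ∀ n, f n ∈ realTest D) {A : ℝ}
    (hA : ∀ n, ‖(realTest.memLp (hf n) 2).toLp‖ ≤ A)
    {l : Lp ℝ 2 (volume : Measure (EuclideanSpace ℝ (Fin d))) → ℝ}
    (hl : ∀ g, Tendsto (fun n => inner ℝ ((realTest.memLp (hf n) 2).toLp) g) atTop (𝓝 (l g)))
    (δ : ℝ) :
    ∃ v : EuclideanSpace ℝ (Fin d) → ℝ, AEStronglyMeasurable v volume ∧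
      Tendsto (fun n => eLpNorm (fun x => ballAverage δ (f n) x - v x) 2 volume) atTop (𝓝 0) := by
  let c : ℝ := ((volume : Measure (EuclideanSpace ℝ (Fin d))).real (Metric.ball 0 δ))⁻¹
  have hc : 0 ≤ c := by positivity
  let I : EuclideanSpace ℝ (Fin d) → Lp ℝ 2 (volume : Measure (EuclideanSpace ℝ (Fin d))) :=
    fun x => indicatorConstLp 2 (measurableSet_ball (x := x) (ε := δ))
      (Metric.isBounded_ball.measure_lt_top.ne) (1 : ℝ)
  have hvol : ∀ x : EuclideanSpace ℝ (Fin d),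
      volume.real (Metric.ball x δ) = volume.real (Metric.ball (0 : EuclideanSpace ℝ (Fin d)) δ) :=
    fun x => by rw [Measure.real, Measure.addHaar_ball_center, Measure.real]
  have hav : ∀ n x, ballAverage δ (f n) x = c * inner ℝ ((realTest.memLp (hf n) 2).toLp) (I x) := by
    intro n x
    rw [real_inner_comm, L2.inner_indicatorConstLp_one, ballAverage, setAverage_eq, hvol,
      smul_eq_mul]
    congr 1
    exact setIntegral_congr_ae measurableSet_ball
      ((MemLp.coeFn_toLp (realTest.memLp (hf n) 2)).mono fun y hy _ => hy.symm)
  obtain ⟨b, hb⟩ : ∃ b, ∀ x, ‖I x‖ ≤ b := by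
    refine ⟨volume.real (Metric.ball (0 : EuclideanSpace ℝ (Fin d)) δ) ^ (1 / (2 : ℝ)), fun x => ?_⟩
    rw [norm_indicatorConstLp (by norm_num) (by norm_num), hvol]
    simp
  have hA0 : 0 ≤ A := (norm_nonneg _).trans (hA 0)
  have hbound : ∀ n x, |ballAverage δ (f n) x| ≤ c * (A * b) := by
    intro n x
    rw [hav, abs_mul, abs_of_nonneg hc]
    refine mul_le_mul_of_nonneg_left ?_ hc
    exact (abs_real_inner_le_norm _ _).trans
      (mul_le_mul (hA n) (hb x) (norm_nonneg _) hA0)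
  obtain ⟨r, hr⟩ := hD.subset_ball 0
  have hzero : ∀ n x, x ∉ Metric.ball (0 : EuclideanSpace ℝ (Fin d)) (r + δ) →
      ballAverage δ (f n) x = 0 := by
    intro n x hx
    rw [ballAverage, setAverage_eq, setIntegral_eq_zero_of_forall_eq_zero, smul_zero]
    intro y hy
    refine realTest.eq_zero (hf n) fun hyD => hx ?_
    have h1 := hr hyD
    rw [mem_ball_zero_iff] at h1 ⊢
    rw [Metric.mem_ball, dist_comm, dist_eq_norm] at hy
    have := norm_add_le y (x - y)
    rw [add_sub_cancel] at this
    linarith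
  let v : EuclideanSpace ℝ (Fin d) → ℝ := fun x => c * l (I x)
  have hlim : ∀ x, Tendsto (fun n => ballAverage δ (f n) x) atTop (𝓝 (v x)) := by
    intro x
    simp_rw [hav]
    exact (hl (I x)).const_mul c
  have hmeas : ∀ n, Measurable (ballAverage δ (f n)) :=
    fun n => measurable_ballAverage (realTest.continuous (hf n)) δ
  have hvm : Measurable v := measurable_of_tendsto_metrizable hmeas (tendsto_pi_nhds.2 hlim)
  have hvb : ∀ x, |v x| ≤ c * (A * b) := fun x =>
    le_of_tendsto' (hlim x).abs fun n => hbound n x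
  have hv0 : ∀ x, x ∉ Metric.ball (0 : EuclideanSpace ℝ (Fin d)) (r + δ) → v x = 0 := fun x hx =>
    tendsto_nhds_unique (hlim x) (by simp [hzero _ x hx])
  refine ⟨v, hvm.aestronglyMeasurable, ?_⟩
  have hsq : Tendsto (fun n => ∫⁻ x, ‖ballAverage δ (f n) x - v x‖ₑ ^ 2) atTop
      (𝓝 (∫⁻ _ : EuclideanSpace ℝ (Fin d), 0)) := by
    refine tendsto_lintegral_of_dominated_convergence
      ((Metric.ball (0 : EuclideanSpace ℝ (Fin d)) (r + δ)).indicator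
        fun _ => ENNReal.ofReal (c * (A * b) + c * (A * b)) ^ 2) ?_ ?_ ?_ ?_
    · exact fun n => ((hmeas n).sub hvm).enorm.pow_const 2
    · refine fun n => Eventually.of_forall fun x => ?_
      by_cases hx : x ∈ Metric.ball (0 : EuclideanSpace ℝ (Fin d)) (r + δ)
      · simp only [indicator_of_mem hx]
        rw [← ofReal_norm]
        gcongr
        exact (norm_sub_le _ _).trans (add_le_add (hbound n x) (hvb x))
      · simp [hzero n x hx, hv0 x hx]
    · rw [lintegral_indicator_const measurableSet_ball]
      exact ENNReal.mul_ne_top (by simp) Metric.isBounded_ball.measure_lt_top.ne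
    · refine Eventually.of_forall fun x => ?_
      have h1 : Tendsto (fun n => ballAverage δ (f n) x - v x) atTop (𝓝 0) := by
        simpa using (hlim x).sub_const (v x)
      have h2 := ((continuous_enorm.tendsto (0 : ℝ)).comp h1)
      simpa [Function.comp_def] using (ENNReal.continuous_pow 2).continuousAt.tendsto.comp h2
  rw [lintegral_zero] at hsq
  simp_rw [← eLpNorm_two_sq] at hsq
  have h3 := (ENNReal.continuous_rpow_const (y := (1 / 2 : ℝ))).continuousAt.tendsto.comp hsq
  simp only [Function.comp_def, ← ENNReal.rpow_natCast, ← ENNReal.rpow_mul] at h3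
  simpa using h3

/-- **Rellich's theorem** for sequences of test functions on a bounded set. -/
theorem exists_subseq_tendsto_of_realTest (hD : Bornology.IsBounded D)
    {f : ℕ → EuclideanSpace ℝ (Fin d) → ℝ} (hf : ∀ n, f n ∈ realTest D) {A B : ℝ≥0∞}
    (hA' : A ≠ ⊤) (hB' : B ≠ ⊤) (hA : ∀ n, eLpNorm (f n) 2 volume ≤ A)
    (hB : ∀ n, eLpNorm (fderiv ℝ (f n)) 2 volume ≤ B) :
    ∃ (φ : ℕ → ℕ) (u : Lp ℝ 2 (volume : Measure (EuclideanSpace ℝ (Fin d)))), StrictMono φ ∧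
      Tendsto (fun n => (realTest.memLp (hf (φ n)) 2).toLp) atTop (𝓝 u) := by
  let F : ℕ → Lp ℝ 2 (volume : Measure (EuclideanSpace ℝ (Fin d))) :=
    fun n => (realTest.memLp (hf n) 2).toLp
  have hFA : ∀ n, ‖F n‖ ≤ A.toReal := by
    intro n
    rw [Lp.norm_toLp]
    exact ENNReal.toReal_mono hA' (hA n)
  let Λ : ℕ → WeakDual ℝ (Lp ℝ 2 (volume : Measure (EuclideanSpace ℝ (Fin d)))) :=
    fun n => StrongDual.toWeakDual (InnerProductSpace.toDual ℝ _ (F n))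
  have : Fact ((2 : ℝ≥0∞) ≠ ⊤) := ⟨by norm_num⟩
  obtain ⟨L, -, φ, hφ, hL⟩ :=
    WeakDual.isSeqCompact_closedBall ℝ (Lp ℝ 2 (volume : Measure (EuclideanSpace ℝ (Fin d))))
      0 A.toReal (x := Λ) (fun n => by
        simpa [Λ] using hFA n)
  have hl : ∀ g, Tendsto (fun n => inner ℝ (F (φ n)) g) atTop (𝓝 (L g)) := by
    intro g
    exact ((WeakDual.eval_continuous g).tendsto L).comp hL
  have key : ∀ η : ℝ≥0∞, η ≠ 0 → ∃ v : EuclideanSpace ℝ (Fin d) → ℝ,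
      AEStronglyMeasurable v volume ∧
      ∃ N, ∀ n ≥ N, eLpNorm (fun x => f (φ n) x - v x) 2 volume ≤ η := by
    intro η hη
    obtain ⟨δ, hδ, hδB⟩ : ∃ δ : ℝ, 0 < δ ∧ ENNReal.ofReal δ * B ≤ η / 2 := by
      have h1 : Tendsto (fun δ : ℝ => ENNReal.ofReal δ * B) (𝓝[>] 0) (𝓝 (ENNReal.ofReal 0 * B)) :=
        (ENNReal.Tendsto.mul_const (ENNReal.continuous_ofReal.tendsto 0) (Or.inr hB')).mono_left
          nhdsWithin_le_nhds
      simp only [ENNReal.ofReal_zero, zero_mul] at h1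
      obtain ⟨δ, h2, h3⟩ := ((h1.eventually_le_const (ENNReal.half_pos hη)).and
        self_mem_nhdsWithin).exists
      exact ⟨δ, h3, h2⟩
    obtain ⟨v, hv, hvl⟩ := exists_tendsto_ballAverage hD (fun n => hf (φ n)) (fun n => hFA (φ n))
      hl δ
    obtain ⟨N, hN⟩ := eventually_atTop.1 (hvl.eventually_le_const (ENNReal.half_pos hη))
    refine ⟨v, hv, N, fun n hn => ?_⟩
    have hm := measurable_ballAverage (realTest.continuous (hf (φ n))) δ
    calc eLpNorm (fun x => f (φ n) x - v x) 2 volume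
        = eLpNorm ((fun x => f (φ n) x - ballAverage δ (f (φ n)) x) +
            fun x => ballAverage δ (f (φ n)) x - v x) 2 volume := by
          congr 1; ext x; simp
      _ ≤ _ := eLpNorm_add_le ((realTest.continuous (hf (φ n))).aestronglyMeasurable.sub
            hm.aestronglyMeasurable) (hm.aestronglyMeasurable.sub hv) (by norm_num)
      _ ≤ η / 2 + η / 2 := by
          refine add_le_add (le_trans ?_ hδB) (hN n hn)
          exact (eLpNorm_sub_ballAverage_le ((hf (φ n)).1.of_le (by simp)) hδ).trans (by
            gcongr; exact hB _)
      _ = η := ENNReal.add_halves η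
  have hcau : CauchySeq fun n => F (φ n) := by
    refine EMetric.cauchySeq_iff.2 fun η hη => ?_
    obtain ⟨ζ, hζ0, hζ⟩ := ENNReal.lt_iff_exists_nnreal_btwn.1 (ENNReal.half_pos hη.ne')
    obtain ⟨v, hv, N, hN⟩ := key ζ hζ0.ne'
    refine ⟨N, fun m hm n hn => ?_⟩
    rw [Lp.edist_toLp_toLp]
    have hfm : ∀ k, AEStronglyMeasurable (f k) volume :=
      fun k => (realTest.continuous (hf k)).aestronglyMeasurable
    calc eLpNorm (f (φ m) - f (φ n)) 2 volume
        = eLpNorm ((fun x => f (φ m) x - v x) - fun x => f (φ n) x - v x) 2 volume := by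
          congr 1; ext x; simp
      _ ≤ _ := eLpNorm_sub_le ((hfm _).sub hv) ((hfm _).sub hv) (by norm_num)
      _ ≤ ζ + ζ := add_le_add (hN m hm) (hN n hn)
      _ < η / 2 + η / 2 := ENNReal.add_lt_add hζ hζ
      _ = η := ENNReal.add_halves η
  obtain ⟨u, hu⟩ := cauchySeq_tendsto_of_complete hcau
  exact ⟨φ, u, hφ, hu⟩

end Rellich

/-! ### The relaxed energy and its minimizers -/

section RelaxedEnergy

variable {d : ℕ} {D : Set (EuclideanSpace ℝ (Fin d))}

theorem GradNormLE.congr_ae {u v : EuclideanSpace ℝ (Fin d) → ℝ} {C : ℝ≥0∞}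
    (h : GradNormLE D u C) (huv : u =ᵐ[volume] v) : GradNormLE D v C := by
  intro ε hε
  obtain ⟨f, hf, h1, h2⟩ := h ε hε
  refine ⟨f, hf, ?_, h2⟩
  rwa [eLpNorm_congr_ae (g := fun x => f x - u x)]
  filter_upwards [huv] with x hx
  rw [hx]

theorem gradNormLE_of_forall_add {u : EuclideanSpace ℝ (Fin d) → ℝ} {C : ℝ≥0∞}
    (h : ∀ ε : ℝ≥0∞, ε ≠ 0 → ∃ C' ≤ C + ε, GradNormLE D u C') : GradNormLE D u C := by
  intro ε hε
  obtain ⟨C', hC', hu⟩ := h (ε / 2) (ENNReal.half_pos hε).ne'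
  obtain ⟨f, hf, h1, h2⟩ := hu (ε / 2) (ENNReal.half_pos hε).ne'
  refine ⟨f, hf, h1.trans ENNReal.half_le_self, h2.trans ?_⟩
  calc C' + ε / 2 ≤ C + ε / 2 + ε / 2 := by gcongr
    _ = C + ε := by rw [add_assoc, ENNReal.add_halves]

theorem gradNormLE_of_realTest {f : EuclideanSpace ℝ (Fin d) → ℝ} (hf : f ∈ realTest D) :
    GradNormLE D f (eLpNorm (fderiv ℝ f) 2 volume) :=
  fun ε _ => ⟨f, hf, by simp, le_self_add⟩

/-- The relaxed gradient norm of `u`: the least `L²` norm of the gradient along approximations of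
`u` by test functions on `D`. -/
def gradNorm (D : Set (EuclideanSpace ℝ (Fin d))) (u : EuclideanSpace ℝ (Fin d) → ℝ) : ℝ≥0∞ :=
  sInf {C | GradNormLE D u C}

theorem gradNorm_le_iff {u : EuclideanSpace ℝ (Fin d) → ℝ} {C : ℝ≥0∞} (hC : C ≠ ⊤) :
    gradNorm D u ≤ C ↔ GradNormLE D u C := by
  refine ⟨fun h => gradNormLE_of_forall_add fun ε hε => ?_, fun h => sInf_le h⟩
  have h1 : gradNorm D u < C + ε := h.trans_lt (ENNReal.lt_add_right hC hε)
  obtain ⟨C', hC', h2⟩ := sInf_lt_iff.1 h1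
  exact ⟨C', h2.le, hC'⟩

theorem gradNorm_congr_ae {u v : EuclideanSpace ℝ (Fin d) → ℝ} (huv : u =ᵐ[volume] v) :
    gradNorm D u = gradNorm D v := by
  have : {C | GradNormLE D u C} = {C | GradNormLE D v C} :=
    Set.ext fun C => ⟨fun h => h.congr_ae huv, fun h => h.congr_ae huv.symm⟩
  rw [gradNorm, gradNorm, this]

theorem lowerSemicontinuous_gradNorm :
    LowerSemicontinuous fun u : Lp ℝ 2 (volume : Measure (EuclideanSpace ℝ (Fin d))) =>
      gradNorm D u := by
  rw [lowerSemicontinuous_iff_isClosed_preimage]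
  intro C
  rcases eq_or_ne C ⊤ with rfl | hC
  · simp
  refine IsSeqClosed.isClosed fun v u hv hvu => ?_
  simp only [mem_preimage, mem_Iic, gradNorm_le_iff hC] at hv ⊢
  intro ε hε
  have h1 : ∀ᶠ n in atTop, edist (v n) u ≤ ε / 2 :=
    (tendsto_iff_edist_tendsto_0.1 hvu).eventually_le_const (ENNReal.half_pos hε)
  obtain ⟨n, hn⟩ := h1.exists
  obtain ⟨f, hf, h2, h3⟩ := hv n (ε / 2) (ENNReal.half_pos hε).ne'
  refine ⟨f, hf, ?_, h3.trans (by gcongr; exact ENNReal.half_le_self)⟩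
  rw [Lp.edist_def] at hn
  have hfm := (realTest.continuous hf).aestronglyMeasurable (μ := volume)
  calc eLpNorm (fun x => f x - u x) 2 volume
      = eLpNorm ((fun x => f x - v n x) + (⇑(v n) - ⇑u)) 2 volume := by
        congr 1; ext x; simp
    _ ≤ _ := eLpNorm_add_le (hfm.sub (Lp.aestronglyMeasurable _))
        ((Lp.aestronglyMeasurable _).sub (Lp.aestronglyMeasurable _)) (by norm_num)
    _ ≤ ε / 2 + ε / 2 := add_le_add h2 hn
    _ = ε := ENNReal.add_halves ε

/-- The energy density `t⁶/6 - t⁴/4`, made non-negative by completing the square, which adds a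
multiple of the mass density `t²`. -/
def wellDensity (t : ℝ) : ℝ := t ^ 2 / 6 * (t ^ 2 - 3 / 4) ^ 2

theorem wellDensity_nonneg (t : ℝ) : 0 ≤ wellDensity t := by
  unfold wellDensity; positivity

theorem wellDensity_eq (t : ℝ) :
    wellDensity t = 1 / 6 * t ^ 6 - 1 / 4 * t ^ 4 + 3 / 32 * t ^ 2 := by
  unfold wellDensity; ring

theorem continuous_wellDensity : Continuous wellDensity := by
  unfold wellDensity; fun_prop

theorem lowerSemicontinuous_lintegral_wellDensity :
    LowerSemicontinuous fun u : Lp ℝ 2 (volume : Measure (EuclideanSpace ℝ (Fin d))) =>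
      ∫⁻ x, ENNReal.ofReal (wellDensity (u x)) := by
  rw [lowerSemicontinuous_iff_isClosed_preimage]
  intro C
  refine IsSeqClosed.isClosed fun v u hv hvu => ?_
  simp only [mem_preimage, mem_Iic] at hv ⊢
  obtain ⟨φ, -, hφ⟩ := (tendstoInMeasure_of_tendsto_Lp hvu).exists_seq_tendsto_ae
  calc ∫⁻ x, ENNReal.ofReal (wellDensity (u x))
      = ∫⁻ x, liminf (fun n => ENNReal.ofReal (wellDensity (v (φ n) x))) atTop := by
        refine lintegral_congr_ae ?_
        filter_upwards [hφ] with x hx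
        refine (Tendsto.liminf_eq ?_).symm
        exact ((ENNReal.continuous_ofReal.comp continuous_wellDensity).tendsto (u x)).comp hx
    _ ≤ liminf (fun n => ∫⁻ x, ENNReal.ofReal (wellDensity (v (φ n) x))) atTop :=
        lintegral_liminf_le' fun n => (ENNReal.continuous_ofReal.comp
          continuous_wellDensity).measurable.comp_aemeasurable (Lp.aestronglyMeasurable _).aemeasurable
    _ ≤ C := by
        refine liminf_le_of_le (by isBoundedDefault) fun b hb => ?_
        obtain ⟨n, hn⟩ := hb.exists
        exact hn.trans (hv _)

/-- The energy of `u`, with the gradient term relaxed to all of `L²` and shifted by a multiple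
of the mass so that it is non-negative. -/
def relaxedEnergy (D : Set (EuclideanSpace ℝ (Fin d))) (u : EuclideanSpace ℝ (Fin d) → ℝ) : ℝ≥0∞ :=
  gradNorm D u ^ 2 / 2 + ∫⁻ x, ENNReal.ofReal (wellDensity (u x))

theorem relaxedEnergy_congr_ae {u v : EuclideanSpace ℝ (Fin d) → ℝ} (huv : u =ᵐ[volume] v) :
    relaxedEnergy D u = relaxedEnergy D v := by
  rw [relaxedEnergy, relaxedEnergy, gradNorm_congr_ae huv]
  congr 1
  refine lintegral_congr_ae ?_
  filter_upwards [huv] with x hx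
  rw [hx]

theorem lowerSemicontinuous_relaxedEnergy :
    LowerSemicontinuous fun u : Lp ℝ 2 (volume : Measure (EuclideanSpace ℝ (Fin d))) =>
      relaxedEnergy D u := by
  refine LowerSemicontinuous.add ?_ lowerSemicontinuous_lintegral_wellDensity
  have hc : Continuous fun t : ℝ≥0∞ => t ^ 2 / 2 :=
    (ENNReal.continuous_div_const 2 (by norm_num)).comp (ENNReal.continuous_pow 2)
  exact hc.comp_lowerSemicontinuous lowerSemicontinuous_gradNorm
    (fun a b hab => by dsimp only; gcongr)

theorem gradNorm_le_of_relaxedEnergy_le {u : EuclideanSpace ℝ (Fin d) → ℝ} {c : ℝ≥0∞}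
    (h : relaxedEnergy D u ≤ c) : gradNorm D u ≤ 2 * c + 1 := by
  have h1 : gradNorm D u ^ 2 ≤ 2 * c := by
    have := le_self_add.trans h
    rw [ENNReal.div_le_iff (by norm_num) (by norm_num)] at this
    rwa [mul_comm]
  rcases le_total (gradNorm D u) 1 with h2 | h2
  · exact h2.trans le_add_self
  · calc gradNorm D u ≤ gradNorm D u ^ 2 := le_self_pow h2 two_ne_zero
      _ ≤ 2 * c + 1 := h1.trans le_self_add

/-- Energy sublevel sets are compact in `L²`: Rellich's theorem for the relaxed energy. -/
theorem isCompact_sublevel (hD : Bornology.IsBounded D) (r : ℝ) {c : ℝ≥0∞} (hc : c ≠ ⊤) :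
    IsCompact {u : Lp ℝ 2 (volume : Measure (EuclideanSpace ℝ (Fin d))) |
      0 ≤ u ∧ ‖u‖ = r ∧ relaxedEnergy D u ≤ c} := by
  refine IsSeqCompact.isCompact fun v hv => ?_
  have hC : 2 * c + 1 ≠ ⊤ := by finiteness
  let e : ℕ → ℝ≥0∞ := fun n => ((n : ℝ≥0∞) + 1)⁻¹
  have he : ∀ n, e n ≠ 0 := fun n => by simp [e]
  have he1 : ∀ n, e n ≤ 1 := fun n => by simp [e]
  have he0 : Tendsto e atTop (𝓝 0) := by
    have := (ENNReal.tendsto_inv_nat_nhds_zero).comp (tendsto_add_atTop_nat 1)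
    refine this.congr fun n => ?_
    simp [e]
  have hex : ∀ n, ∃ f ∈ realTest D, eLpNorm (fun x => f x - v n x) 2 volume ≤ e n ∧
      eLpNorm (fderiv ℝ f) 2 volume ≤ 2 * c + 1 + e n := fun n =>
    (gradNorm_le_iff hC).1 (gradNorm_le_of_relaxedEnergy_le (hv n).2.2) (e n) (he n)
  choose f hf hfv hfC using hex
  have hdist : ∀ n, edist ((realTest.memLp (hf n) 2).toLp) (v n) ≤ e n := by
    intro n
    rw [Lp.edist_def]
    refine (eLpNorm_congr_ae ?_).trans_le (hfv n)
    filter_upwards [(realTest.memLp (hf n) 2).coeFn_toLp] with x hx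
    simp [hx]
  obtain ⟨φ, u, hφ, hu⟩ := exists_subseq_tendsto_of_realTest hD hf
    (A := ENNReal.ofReal r + 1) (B := 2 * c + 1 + 1) (by finiteness) (by finiteness)
    (fun n => by
      have h1 : edist ((realTest.memLp (hf n) 2).toLp) 0 ≤ 1 + ENNReal.ofReal r := by
        refine (edist_triangle _ (v n) _).trans (add_le_add ((hdist n).trans (he1 n)) ?_)
        rw [edist_zero_right, ← (hv n).2.1, ofReal_norm]
      rw [edist_zero_right, Lp.enorm_toLp, add_comm] at h1
      exact h1)
    (fun n => (hfC n).trans (by gcongr; exact he1 n))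
  have hvu : Tendsto (v ∘ φ) atTop (𝓝 u) := by
    rw [tendsto_iff_edist_tendsto_0] at hu ⊢
    have h1 := (he0.comp hφ.tendsto_atTop).add hu
    rw [add_zero] at h1
    refine tendsto_of_tendsto_of_tendsto_of_le_of_le tendsto_const_nhds h1 (fun _ => zero_le)
      fun n => ?_
    refine (edist_triangle _ ((realTest.memLp (hf (φ n)) 2).toLp) _).trans ?_
    refine add_le_add ?_ le_rfl
    rw [edist_comm]
    exact hdist _
  refine ⟨u, ⟨?_, ?_, ?_⟩, φ, hφ, hvu⟩
  · exact ge_of_tendsto' hvu fun n => (hv _).1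
  · exact tendsto_nhds_unique hvu.norm (by simp [(hv _).2.1])
  · exact (lowerSemicontinuous_relaxedEnergy.isClosed_preimage c).mem_of_tendsto hvu
      (Eventually.of_forall fun n => (hv _).2.2)

/-- Existence of minimizers of the relaxed energy; among all minimizers one can choose one that
maximizes a given continuous linear functional. -/
theorem exists_minimizer (hD : Bornology.IsBounded D) {r : ℝ}
    (w : Lp ℝ 2 (volume : Measure (EuclideanSpace ℝ (Fin d))))
    {v₀ : Lp ℝ 2 (volume : Measure (EuclideanSpace ℝ (Fin d)))} (h0 : 0 ≤ v₀) (hr : ‖v₀‖ = r)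
    (hfin : relaxedEnergy D v₀ ≠ ⊤) :
    ∃ u : Lp ℝ 2 (volume : Measure (EuclideanSpace ℝ (Fin d))), 0 ≤ u ∧ ‖u‖ = r ∧
      relaxedEnergy D u ≠ ⊤ ∧
      ∀ v : Lp ℝ 2 (volume : Measure (EuclideanSpace ℝ (Fin d))), 0 ≤ v → ‖v‖ = r →
        relaxedEnergy D u ≤ relaxedEnergy D v ∧
        (relaxedEnergy D v ≤ relaxedEnergy D u → inner ℝ w v ≤ inner ℝ w u) := by
  obtain ⟨u₀, hu₀, hmin⟩ := LowerSemicontinuousOn.exists_isMinOn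
    (f := fun u : Lp ℝ 2 (volume : Measure (EuclideanSpace ℝ (Fin d))) => relaxedEnergy D u)
    (s := {u | 0 ≤ u ∧ ‖u‖ = r ∧ relaxedEnergy D u ≤ relaxedEnergy D v₀})
    ⟨v₀, h0, hr, le_rfl⟩ (isCompact_sublevel hD r hfin)
    ((lowerSemicontinuous_relaxedEnergy (D := D)).lowerSemicontinuousOn _)
  have hmin' : ∀ v : Lp ℝ 2 (volume : Measure (EuclideanSpace ℝ (Fin d))), 0 ≤ v → ‖v‖ = r →
      relaxedEnergy D u₀ ≤ relaxedEnergy D v := by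
    intro v hv hvr
    rcases le_total (relaxedEnergy D v) (relaxedEnergy D v₀) with h | h
    · exact hmin ⟨hv, hvr, h⟩
    · exact hu₀.2.2.trans h
  have hfin₀ : relaxedEnergy D u₀ ≠ ⊤ := ne_top_of_le_ne_top hfin hu₀.2.2
  obtain ⟨u, hu, hmax⟩ := (isCompact_sublevel hD r hfin₀).exists_isMaxOn
    ⟨u₀, hu₀.1, hu₀.2.1, le_rfl⟩
    (f := fun v : Lp ℝ 2 (volume : Measure (EuclideanSpace ℝ (Fin d))) => inner ℝ w v)
    (by fun_prop)
  refine ⟨u, hu.1, hu.2.1, ne_top_of_le_ne_top hfin₀ hu.2.2, fun v hv hvr => ⟨?_, fun h => ?_⟩⟩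
  · exact hu.2.2.trans (hmin' v hv hvr)
  · exact hmax ⟨hv, hvr, h.trans hu.2.2⟩

end RelaxedEnergy

/-! ### Gradients of test functions -/

section Gradient

variable {d : ℕ} {D : Set (EuclideanSpace ℝ (Fin d))}

theorem norm_fderiv_le_classicalGradient (φ : EuclideanSpace ℝ (Fin d) → ℂ)
    (x : EuclideanSpace ℝ (Fin d)) : ‖fderiv ℝ φ x‖ ≤ ‖classicalGradient φ x‖ := by
  refine ContinuousLinearMap.opNorm_le_bound _ (norm_nonneg _) fun v => ?_
  have hv : v = ∑ i, v i • EuclideanSpace.single i (1 : ℝ) := by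
    have := (EuclideanSpace.basisFun (Fin d) ℝ).sum_repr v
    simpa using this.symm
  have h1 : fderiv ℝ φ x v = ∑ i, v i • classicalGradient φ x i := by
    conv_lhs => rw [hv]
    simp [classicalGradient]
  have h2 : ‖fderiv ℝ φ x v‖ ≤ ∑ i, ‖classicalGradient φ x i‖ * ‖v i‖ := by
    rw [h1]
    refine (norm_sum_le _ _).trans (Finset.sum_le_sum fun i _ => ?_)
    rw [norm_smul, mul_comm]
  rw [EuclideanSpace.norm_eq, EuclideanSpace.norm_eq]
  exact h2.trans (Real.sum_mul_le_sqrt_mul_sqrt _ _ _)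

theorem classicalGradient_ofReal_apply {f : EuclideanSpace ℝ (Fin d) → ℝ}
    {x : EuclideanSpace ℝ (Fin d)} (hf : DifferentiableAt ℝ f x) (i : Fin d) :
    classicalGradient (fun y => (f y : ℂ)) x i =
      (fderiv ℝ f x (EuclideanSpace.single i (1 : ℝ)) : ℂ) := by
  have h := (Complex.ofRealCLM.hasFDerivAt (x := f x)).comp x hf.hasFDerivAt
  have h' : fderiv ℝ (fun y => (f y : ℂ)) x = Complex.ofRealCLM.comp (fderiv ℝ f x) := h.fderiv
  simp [classicalGradient, h']

theorem norm_classicalGradient_ofReal {f : EuclideanSpace ℝ (Fin d) → ℝ}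
    {x : EuclideanSpace ℝ (Fin d)} (hf : DifferentiableAt ℝ f x) :
    ‖classicalGradient (fun y => (f y : ℂ)) x‖ = ‖fderiv ℝ f x‖ := by
  set g := (InnerProductSpace.toDual ℝ (EuclideanSpace ℝ (Fin d))).symm (fderiv ℝ f x) with hg
  have h1 : ‖g‖ = ‖fderiv ℝ f x‖ := LinearIsometryEquiv.norm_map _ _
  have h2 : ∀ i, fderiv ℝ f x (EuclideanSpace.single i (1 : ℝ)) = g i := by
    intro i
    have : inner ℝ g (EuclideanSpace.single i (1 : ℝ)) =
        fderiv ℝ f x (EuclideanSpace.single i (1 : ℝ)) :=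
      InnerProductSpace.toDual_symm_apply
    rw [← this, EuclideanSpace.inner_single_right]
    simp
  rw [← h1, EuclideanSpace.norm_eq, EuclideanSpace.norm_eq]
  simp [classicalGradient_ofReal_apply hf, h2]

theorem continuous_classicalGradient {φ : EuclideanSpace ℝ (Fin d) → ℂ} (hφ : ContDiff ℝ ∞ φ) :
    Continuous (classicalGradient φ) := by
  have h : Continuous (fderiv ℝ φ) := hφ.continuous_fderiv (by simp)
  unfold classicalGradient
  fun_prop

theorem hasCompactSupport_classicalGradient {φ : EuclideanSpace ℝ (Fin d) → ℂ}
    (hφ : HasCompactSupport φ) : HasCompactSupport (classicalGradient φ) := by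
  refine (hφ.fderiv (𝕜 := ℝ)).mono' fun x hx => subset_tsupport _ ?_
  rw [Function.mem_support] at hx ⊢
  contrapose! hx
  ext i
  simp [classicalGradient, hx]

theorem memLp_classicalGradient {φ : EuclideanSpace ℝ (Fin d) → ℂ} (hφ : IsTestFunction D φ)
    (p : ℝ≥0∞) (μ : Measure (EuclideanSpace ℝ (Fin d))) [IsFiniteMeasureOnCompacts μ] :
    MemLp (classicalGradient φ) p μ :=
  (continuous_classicalGradient hφ.1).memLp_of_hasCompactSupport
    (hasCompactSupport_classicalGradient hφ.2.1)

theorem isTestFunction_ofReal {f : EuclideanSpace ℝ (Fin d) → ℝ} (hf : f ∈ realTest D) :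
    IsTestFunction D fun x => (f x : ℂ) := by
  have hs : Function.support (fun x => (f x : ℂ)) = Function.support f := by
    ext x; simp
  refine ⟨Complex.ofRealCLM.contDiff.comp hf.1, ?_, ?_⟩
  · have := hf.2.1
    unfold HasCompactSupport tsupport at *
    rwa [hs]
  · unfold tsupport
    rw [hs]
    exact hf.2.2

theorem realTest.eLpNorm_fderiv_restrict {f : EuclideanSpace ℝ (Fin d) → ℝ} (hf : f ∈ realTest D)
    (p : ℝ≥0∞) :
    eLpNorm (fderiv ℝ f) p (volume.restrict D) = eLpNorm (fderiv ℝ f) p volume := by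
  have h : Function.support (fun x => ‖fderiv ℝ f x‖) ⊆ D := fun x hx =>
    hf.2.2 (support_fderiv_subset ℝ fun h => hx (by simp [h]))
  rw [← eLpNorm_norm, eLpNorm_restrict_eq_of_support_subset h, eLpNorm_norm]

/-- Functions supported in a bounded set are small in `L²` if they are uniformly small. -/
theorem exists_pos_forall_eLpNorm_le (hD : Bornology.IsBounded D) {η : ℝ≥0∞} (hη : η ≠ 0) :
    ∃ ε : ℝ, 0 < ε ∧ ∀ g : EuclideanSpace ℝ (Fin d) → ℝ, (∀ x, |g x| ≤ ε) →
      (∀ x ∉ D, g x = 0) → eLpNorm g 2 volume ≤ η := by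
  set M : ℝ≥0∞ := volume D ^ (2 : ℝ≥0∞).toReal⁻¹ with hM
  have hM' : M ≠ ⊤ := by
    have := hD.measure_lt_top (μ := volume) |>.ne
    finiteness
  have h1 : Tendsto (fun δ : ℝ => M * ENNReal.ofReal δ) (𝓝[>] 0) (𝓝 (M * ENNReal.ofReal 0)) :=
    (ENNReal.Tendsto.const_mul (ENNReal.continuous_ofReal.tendsto 0) (Or.inr hM')).mono_left
      nhdsWithin_le_nhds
  simp only [ENNReal.ofReal_zero, mul_zero] at h1
  obtain ⟨ε, h2, h3⟩ := ((h1.eventually_le_const (pos_iff_ne_zero.2 hη)).and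
    self_mem_nhdsWithin).exists
  refine ⟨ε, h3, fun g hg hg0 => le_trans ?_ h2⟩
  have hsupp : Function.support g ⊆ D := fun x hx => by
    by_contra h
    exact hx (hg0 x h)
  rw [← eLpNorm_restrict_eq_of_support_subset hsupp]
  refine (eLpNorm_le_of_ae_bound (C := ε) (Eventually.of_forall hg)).trans_eq ?_
  simp [hM]

end Gradient

/-! ### The modulus of a complex function -/

section Modulus

variable {d : ℕ} {D : Set (EuclideanSpace ℝ (Fin d))}

/-- The smooth approximation `√(|φ|² + ε²) - ε` of the modulus of `φ`. -/
def smoothModulus (ε : ℝ) (φ : EuclideanSpace ℝ (Fin d) → ℂ) (x : EuclideanSpace ℝ (Fin d)) : ℝ :=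
  √(‖φ x‖ ^ 2 + ε ^ 2) - ε

theorem smoothModulus_eq_zero {ε : ℝ} (hε : 0 ≤ ε) {φ : EuclideanSpace ℝ (Fin d) → ℂ}
    {x : EuclideanSpace ℝ (Fin d)} (hx : φ x = 0) : smoothModulus ε φ x = 0 := by
  simp [smoothModulus, hx, Real.sqrt_sq hε]

theorem abs_smoothModulus_sub_le {ε : ℝ} (hε : 0 ≤ ε) (φ : EuclideanSpace ℝ (Fin d) → ℂ)
    (x : EuclideanSpace ℝ (Fin d)) : |smoothModulus ε φ x - ‖φ x‖| ≤ ε := by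
  have h1 : ‖φ x‖ ≤ √(‖φ x‖ ^ 2 + ε ^ 2) := Real.le_sqrt_of_sq_le (by nlinarith)
  have h2 : √(‖φ x‖ ^ 2 + ε ^ 2) ≤ ‖φ x‖ + ε :=
    Real.sqrt_le_iff.2 ⟨by positivity, by nlinarith [norm_nonneg (φ x)]⟩
  rw [abs_le, smoothModulus]
  constructor <;> linarith

theorem smoothModulus_mem_realTest {ε : ℝ} (hε : 0 < ε) {φ : EuclideanSpace ℝ (Fin d) → ℂ}
    (hφ : IsTestFunction D φ) : smoothModulus ε φ ∈ realTest D := by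
  have hsub : Function.support (smoothModulus ε φ) ⊆ Function.support φ := fun x hx h =>
    hx (smoothModulus_eq_zero hε.le h)
  refine ⟨?_, hφ.2.1.mono hsub, (closure_mono hsub).trans hφ.2.2⟩
  have h1 : ContDiff ℝ ∞ fun x => ‖φ x‖ ^ 2 + ε ^ 2 := (hφ.1.norm_sq ℝ).add contDiff_const
  exact (h1.sqrt fun x => by positivity).sub contDiff_const

theorem norm_fderiv_smoothModulus_le {ε : ℝ} (hε : 0 < ε) {φ : EuclideanSpace ℝ (Fin d) → ℂ}
    (hφ : Differentiable ℝ φ) (x : EuclideanSpace ℝ (Fin d)) :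
    ‖fderiv ℝ (smoothModulus ε φ) x‖ ≤ ‖fderiv ℝ φ x‖ := by
  have h1 := (((hφ x).hasFDerivAt.norm_sq.add_const (ε ^ 2)).sqrt (by positivity)).sub_const ε
  have h2 : HasFDerivAt (smoothModulus ε φ) _ x := h1
  rw [h2.fderiv]
  refine ContinuousLinearMap.opNorm_le_bound _ (norm_nonneg _) fun v => ?_
  set s := √(‖φ x‖ ^ 2 + ε ^ 2) with hs
  have hs0 : 0 < s := Real.sqrt_pos.2 (by positivity)
  have hφs : ‖φ x‖ ≤ s := Real.le_sqrt_of_sq_le (by nlinarith)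
  have h3 : |inner ℝ (φ x) (fderiv ℝ φ x v)| ≤ s * (‖fderiv ℝ φ x‖ * ‖v‖) :=
    (abs_real_inner_le_norm _ _).trans (mul_le_mul hφs (ContinuousLinearMap.le_opNorm _ _)
      (norm_nonneg _) hs0.le)
  have h4 : ∀ t : ℝ, |1 / (2 * s) * (2 * t)| = |t| / s := by
    intro t
    rw [show 1 / (2 * s) * (2 * t) = t / s by field_simp, abs_div, abs_of_pos hs0]
  simp only [_root_.smul_apply, ContinuousLinearMap.comp_apply, innerSL_apply_apply,
    smul_eq_mul, Real.norm_eq_abs, nsmul_eq_mul, Nat.cast_ofNat]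
  rw [h4, div_le_iff₀ hs0]
  linarith

theorem H10.aestronglyMeasurable {Φ : EuclideanSpace ℝ (Fin d) → ℂ} (hΦ : Φ ∈ H10 D) :
    AEStronglyMeasurable Φ (volume.restrict D) := hΦ.1.1.1

theorem isWeakGradient_weakGradient {Φ : EuclideanSpace ℝ (Fin d) → ℂ}
    (h : ∃ G, IsWeakGradient D Φ G) : IsWeakGradient D Φ (weakGradient D Φ) := by
  rw [weakGradient, dif_pos h]
  exact h.choose_spec

theorem H10.memLp_weakGradient {Φ : EuclideanSpace ℝ (Fin d) → ℂ} (hΦ : Φ ∈ H10 D) :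
    MemLp (weakGradient D Φ) 2 (volume.restrict D) := by
  obtain ⟨⟨-, G, hG, -⟩, φ, hφ, -, hlim⟩ := hΦ
  have hW := (isWeakGradient_weakGradient ⟨G, hG⟩).2.1.aestronglyMeasurable
  obtain ⟨n, hn⟩ := (hlim.eventually_lt_const (zero_lt_one)).exists
  have hm := memLp_classicalGradient (hφ n) 2 (volume.restrict D)
  have h1 : MemLp (fun x => classicalGradient (φ n) x - weakGradient D Φ x) 2
      (volume.restrict D) := ⟨hm.1.sub hW, hn.trans ENNReal.one_lt_top⟩
  have h2 := hm.sub h1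
  rwa [show classicalGradient (φ n) - (fun x => classicalGradient (φ n) x - weakGradient D Φ x) =
    weakGradient D Φ by ext1 x; simp] at h2

/-- The modulus of a function in `H¹₀(D)` lies in `H¹₀(D)`, with no larger gradient norm. -/
theorem gradNormLE_norm (hD : Bornology.IsBounded D) (hDm : MeasurableSet D)
    {Φ : EuclideanSpace ℝ (Fin d) → ℂ} (hΦ : Φ ∈ H10 D) :
    GradNormLE D (D.indicator fun x => ‖Φ x‖)
      (eLpNorm (weakGradient D Φ) 2 (volume.restrict D)) := by
  intro η hη
  obtain ⟨φ, hφ, hlim, hlim'⟩ := hΦ.2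
  have hη2 := ENNReal.half_pos hη
  obtain ⟨n, hn, hn'⟩ := ((hlim.eventually_le_const hη2).and
    (hlim'.eventually_le_const hη2)).exists
  obtain ⟨ε, hε, hsmall⟩ := exists_pos_forall_eLpNorm_le hD hη2.ne'
  have hf := smoothModulus_mem_realTest hε (hφ n)
  have hzero : ∀ x ∉ D, φ n x = 0 := fun x hx =>
    image_eq_zero_of_notMem_tsupport fun h => hx ((hφ n).2.2 h)
  have hcont := (hφ n).1.continuous
  refine ⟨_, hf, ?_, ?_⟩
  · have h1 : eLpNorm (fun x => ‖φ n x‖ - D.indicator (fun x => ‖Φ x‖) x) 2 volume ≤ η / 2 := by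
      refine le_trans ?_ hn
      rw [← eLpNorm_restrict_eq_of_support_subset (s := D)]
      · refine eLpNorm_mono_ae ?_
        filter_upwards [ae_restrict_mem hDm] with x hx
        rw [indicator_of_mem hx]
        exact abs_norm_sub_norm_le _ _
      · intro x hx
        by_contra h
        exact hx (by simp [h, hzero x h])
    have h2 : eLpNorm (fun x => smoothModulus ε (φ n) x - ‖φ n x‖) 2 volume ≤ η / 2 := by
      refine hsmall _ (fun x => abs_smoothModulus_sub_le hε.le _ x) fun x hx => ?_
      simp [smoothModulus_eq_zero hε.le (hzero x hx), hzero x hx]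
    have hmeas : AEStronglyMeasurable (D.indicator fun x => ‖Φ x‖) volume :=
      (aestronglyMeasurable_indicator_iff hDm).2 (H10.aestronglyMeasurable hΦ).norm
    calc eLpNorm (fun x => smoothModulus ε (φ n) x - D.indicator (fun x => ‖Φ x‖) x) 2 volume
        = eLpNorm ((fun x => smoothModulus ε (φ n) x - ‖φ n x‖) +
            fun x => ‖φ n x‖ - D.indicator (fun x => ‖Φ x‖) x) 2 volume := by
          congr 1; ext x; simp
      _ ≤ _ := eLpNorm_add_le ((realTest.continuous hf).aestronglyMeasurable.sub
          hcont.norm.aestronglyMeasurable) (hcont.norm.aestronglyMeasurable.sub hmeas)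
          (by norm_num)
      _ ≤ η / 2 + η / 2 := add_le_add h2 h1
      _ = η := ENNReal.add_halves η
  · rw [← realTest.eLpNorm_fderiv_restrict hf]
    have hgm := memLp_classicalGradient (hφ n) 2 (volume.restrict D)
    calc eLpNorm (fderiv ℝ (smoothModulus ε (φ n))) 2 (volume.restrict D)
        ≤ eLpNorm (classicalGradient (φ n)) 2 (volume.restrict D) :=
          eLpNorm_mono fun x => (norm_fderiv_smoothModulus_le hε
            ((hφ n).1.differentiable (by simp)) x).trans (norm_fderiv_le_classicalGradient _ x)
      _ = eLpNorm (weakGradient D Φ + fun x => classicalGradient (φ n) x - weakGradient D Φ x) 2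
            (volume.restrict D) := by congr 1; ext x; simp
      _ ≤ _ := eLpNorm_add_le (H10.memLp_weakGradient hΦ).1
            (hgm.1.sub (H10.memLp_weakGradient hΦ).1) (by norm_num)
      _ ≤ _ := by gcongr; exact hn'.trans ENNReal.half_le_self

end Modulus

/-! ### Closedness of the gradient -/

section WeakGradient

variable {d : ℕ} {D : Set (EuclideanSpace ℝ (Fin d))}

theorem locallyIntegrableOn_of_memLp_two {F : Type*} [NormedAddCommGroup F]
    (hD : Bornology.IsBounded D) {g : EuclideanSpace ℝ (Fin d) → F}
    (hg : MemLp g 2 (volume.restrict D)) : LocallyIntegrableOn g D volume := by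
  have : IsFiniteMeasure (volume.restrict D) := ⟨by simpa using hD.measure_lt_top⟩
  have h1 : IntegrableOn g D volume := hg.integrable (by norm_num)
  exact h1.locallyIntegrableOn

/-- Locally integrable functions can be integrated against continuous functions with compact
support in the domain. -/
theorem integrableOn_mul_of_locallyIntegrableOn {g φ : EuclideanSpace ℝ (Fin d) → ℂ}
    (hg : LocallyIntegrableOn g D volume) (hφ : Continuous φ) (hφc : HasCompactSupport φ)
    (hφD : tsupport φ ⊆ D) : IntegrableOn (fun x => g x * φ x) D volume := by
  have h1 : IntegrableOn (fun x => g x * φ x) (tsupport φ) volume :=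
    (hg.integrableOn_compact_subset hφD hφc).mul_continuousOn hφ.continuousOn hφc
  refine Integrable.integrableOn ((integrableOn_iff_integrable_of_support_subset ?_).1 h1)
  exact fun x hx => subset_tsupport _ (right_ne_zero_of_mul hx)

theorem locallyIntegrableOn_apply {G : EuclideanSpace ℝ (Fin d) → EuclideanSpace ℂ (Fin d)}
    (hG : LocallyIntegrableOn G D volume) (i : Fin d) :
    LocallyIntegrableOn (fun x => G x i) D volume := by
  intro x hx
  obtain ⟨s, hs, hGs⟩ := hG x hx
  exact ⟨s, hs, (EuclideanSpace.proj (𝕜 := ℂ) i : EuclideanSpace ℂ (Fin d) →L[ℂ] ℂ).integrable_comp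
    hGs⟩

/-- Weak gradients are unique up to null sets. -/
theorem IsWeakGradient.ae_eq (hDo : IsOpen D) {u : EuclideanSpace ℝ (Fin d) → ℂ}
    {G W : EuclideanSpace ℝ (Fin d) → EuclideanSpace ℂ (Fin d)} (hG : IsWeakGradient D u G)
    (hW : IsWeakGradient D u W) : G =ᵐ[volume.restrict D] W := by
  have key : ∀ i, ∀ᵐ x, x ∈ D → G x i - W x i = 0 := by
    intro i
    have hGi := locallyIntegrableOn_apply hG.2.1 i
    have hWi := locallyIntegrableOn_apply hW.2.1 i
    refine hDo.ae_eq_zero_of_integral_contDiff_smul_eq_zero (hGi.sub hWi) fun g hg hgc hgD => ?_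
    have hφ := isTestFunction_ofReal (D := D) (f := g) ⟨hg, hgc, hgD⟩
    have hGφ := integrableOn_mul_of_locallyIntegrableOn hGi hφ.1.continuous hφ.2.1 hφ.2.2
    have hWφ := integrableOn_mul_of_locallyIntegrableOn hWi hφ.1.continuous hφ.2.1 hφ.2.2
    have h1 := hG.2.2 _ hφ i
    rw [hW.2.2 _ hφ i, neg_inj] at h1
    have h2 : ∫ x, g x • (G x i - W x i) = ∫ x in D, (G x i * (g x : ℂ) - W x i * (g x : ℂ)) := by
      rw [← setIntegral_eq_integral_of_forall_compl_eq_zero (s := D)]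
      · refine integral_congr_ae (Eventually.of_forall fun x => ?_)
        simp only [Complex.real_smul]
        ring
      · intro x hx
        rw [image_eq_zero_of_notMem_tsupport fun h => hx (hgD h), zero_smul]
    refine h2.trans ?_
    rw [integral_sub hGφ hWφ, h1, sub_self]
  rw [Filter.EventuallyEq, ae_restrict_iff' hDo.measurableSet]
  filter_upwards [ae_all_iff.2 key] with x hx hxD
  ext i
  exact sub_eq_zero.1 (hx i hxD)

/-- Integration by parts for test functions. -/
theorem integral_mul_classicalGradient {f φ : EuclideanSpace ℝ (Fin d) → ℂ}
    (hf : IsTestFunction D f) (hφ : IsTestFunction D φ) (i : Fin d) :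
    ∫ x in D, f x * classicalGradient φ x i = - ∫ x in D, classicalGradient f x i * φ x := by
  have hf0 : ∀ x ∉ D, f x = 0 := fun x hx =>
    image_eq_zero_of_notMem_tsupport fun h => hx (hf.2.2 h)
  have hφ0 : ∀ x ∉ D, φ x = 0 := fun x hx =>
    image_eq_zero_of_notMem_tsupport fun h => hx (hφ.2.2 h)
  rw [setIntegral_eq_integral_of_forall_compl_eq_zero fun x hx => by simp [hf0 x hx],
    setIntegral_eq_integral_of_forall_compl_eq_zero fun x hx => by simp [hφ0 x hx]]
  have hcf := hf.1.continuous
  have hcφ := hφ.1.continuous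
  have hdf : Continuous (fderiv ℝ f) := hf.1.continuous_fderiv (by simp)
  have hdφ : Continuous (fderiv ℝ φ) := hφ.1.continuous_fderiv (by simp)
  refine integral_mul_fderiv_eq_neg_fderiv_mul_of_integrable ?_ ?_ ?_
    (fun x _ => (hf.1.differentiable (by simp)) x) (fun x _ => (hφ.1.differentiable (by simp)) x)
  · exact Continuous.integrable_of_hasCompactSupport (by fun_prop) hφ.2.1.mul_left
  · exact Continuous.integrable_of_hasCompactSupport (by fun_prop) hf.2.1.mul_right
  · exact Continuous.integrable_of_hasCompactSupport (by fun_prop) hφ.2.1.mul_left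

/-- Pairing with a fixed `L²` function is continuous under `L²` convergence. -/
theorem tendsto_integral_mul_of_tendsto_eLpNorm {α : Type*} [MeasurableSpace α] {μ : Measure α}
    {a : ℕ → α → ℂ} {b ψ : α → ℂ} (ha : ∀ n, MemLp (a n) 2 μ) (hb : MemLp b 2 μ)
    (hψ : MemLp ψ 2 μ) (h : Tendsto (fun n => eLpNorm (a n - b) 2 μ) atTop (𝓝 0)) :
    Tendsto (fun n => ∫ x, a n x * ψ x ∂μ) atTop (𝓝 (∫ x, b x * ψ x ∂μ)) := by
  refine tendsto_integral_of_L1' _ (hb.integrable_mul hψ).1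
    (Eventually.of_forall fun n => (ha n).integrable_mul hψ) ?_
  have h1 : Tendsto (fun n => eLpNorm (a n - b) 2 μ * eLpNorm ψ 2 μ) atTop (𝓝 0) := by
    simpa using ENNReal.Tendsto.mul_const h (Or.inr hψ.2.ne)
  refine tendsto_of_tendsto_of_tendsto_of_le_of_le tendsto_const_nhds h1 (fun _ => zero_le)
    fun n => ?_
  have h2 := eLpNorm_smul_le_mul_eLpNorm (p := 2) (q := 2) (r := 1) hψ.1 ((ha n).1.sub hb.1)
  refine le_trans (le_of_eq ?_) h2
  congr 1
  ext x
  simp [sub_mul]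

theorem norm_toLp_classicalGradient_le {f : EuclideanSpace ℝ (Fin d) → ℝ} (hf : f ∈ realTest D) :
    ‖(memLp_classicalGradient (isTestFunction_ofReal hf) 2 (volume.restrict D)).toLp‖ ≤
      (eLpNorm (fderiv ℝ f) 2 volume).toReal := by
  rw [Lp.norm_toLp]
  refine ENNReal.toReal_mono (realTest.memLp_fderiv hf 2).2.ne ?_
  rw [← realTest.eLpNorm_fderiv_restrict hf]
  exact eLpNorm_mono fun x =>
    (norm_classicalGradient_ofReal ((realTest.differentiable hf) x)).le

/-- The gradient as a linear map from test functions to `L²`. -/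
def gradientMap (D : Set (EuclideanSpace ℝ (Fin d))) :
    realTest D →ₗ[ℝ] Lp (EuclideanSpace ℂ (Fin d)) 2 (volume.restrict D) where
  toFun f := (memLp_classicalGradient (isTestFunction_ofReal f.2) 2 (volume.restrict D)).toLp
  map_add' f g := by
    rw [← MemLp.toLp_add]
    congr 1
    ext x i
    have hf := (realTest.differentiable f.2) x
    have hg := (realTest.differentiable g.2) x
    rw [Pi.add_apply, PiLp.add_apply, classicalGradient_ofReal_apply hf,
      classicalGradient_ofReal_apply hg]
    rw [classicalGradient_ofReal_apply (realTest.differentiable (f + g).2 x), Submodule.coe_add,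
      fderiv_add hf hg]
    simp
  map_smul' c f := by
    rw [RingHom.id_apply, ← MemLp.toLp_const_smul]
    congr 1
    ext x i
    have hf := (realTest.differentiable f.2) x
    rw [Pi.smul_apply, PiLp.smul_apply, classicalGradient_ofReal_apply hf,
      classicalGradient_ofReal_apply (realTest.differentiable (c • f).2 x), Submodule.coe_smul,
      fderiv_const_smul hf]
    simp

/-- The inclusion of test functions into `L²` as a linear map. -/
def inclusionMap (D : Set (EuclideanSpace ℝ (Fin d))) :
    realTest D →ₗ[ℝ] Lp ℝ 2 (volume : Measure (EuclideanSpace ℝ (Fin d))) where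
  toFun f := (realTest.memLp f.2 2).toLp
  map_add' _ _ := rfl
  map_smul' _ _ := rfl

/-- Closedness of the gradient: a finite bound for the relaxed gradient norm gives an element
of `H¹₀(D)` whose weak gradient satisfies the same bound. -/
theorem mem_H10_of_gradNormLE (hDo : IsOpen D) (hD : Bornology.IsBounded D)
    {u : EuclideanSpace ℝ (Fin d) → ℝ} (hu : MemLp u 2 volume) {C : ℝ≥0∞} (hC : C ≠ ⊤)
    (h : GradNormLE D u C) :
    (fun x => (u x : ℂ)) ∈ H10 D ∧
      eLpNorm (weakGradient D fun x => (u x : ℂ)) 2 (volume.restrict D) ≤ C := by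
  obtain ⟨v, G, hv, hG, hGC⟩ := exists_seq_tendsto_of_norm_le (𝕜 := ℂ) (inclusionMap D)
    (gradientMap D) hu.toLp (C := C.toReal) ENNReal.toReal_nonneg (fun ε hε => by
      obtain ⟨f, hf, h1, h2⟩ := h (ENNReal.ofReal ε) (by simpa using hε)
      refine ⟨⟨f, hf⟩, ?_, ?_⟩
      · rw [← dist_eq_norm, dist_edist]
        refine ENNReal.toReal_le_of_le_ofReal hε.le (le_trans (le_of_eq ?_) h1)
        exact Lp.edist_toLp_toLp _ _ (realTest.memLp hf 2) hu
      · refine (norm_toLp_classicalGradient_le hf).trans ?_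
        refine (ENNReal.toReal_mono (by finiteness) h2).trans_eq ?_
        rw [ENNReal.toReal_add hC ENNReal.ofReal_ne_top, ENNReal.toReal_ofReal hε.le])
  have hvt : ∀ n, IsTestFunction D fun x => ((v n : EuclideanSpace ℝ (Fin d) → ℝ) x : ℂ) :=
    fun n => isTestFunction_ofReal (v n).2
  have huc : MemLp (fun x => (u x : ℂ)) 2 (volume.restrict D) := (hu.restrict D).ofReal
  have hvc : ∀ n, MemLp (fun x => ((v n : EuclideanSpace ℝ (Fin d) → ℝ) x : ℂ)) 2
      (volume.restrict D) := fun n => ((realTest.memLp (v n).2 2).restrict D).ofReal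
  have hvg : ∀ n, MemLp (classicalGradient fun x =>
      ((v n : EuclideanSpace ℝ (Fin d) → ℝ) x : ℂ)) 2 (volume.restrict D) :=
    fun n => memLp_classicalGradient (hvt n) 2 _
  have hconv : Tendsto (fun n => eLpNorm ((fun x => ((v n : EuclideanSpace ℝ (Fin d) → ℝ) x : ℂ)) -
      fun x => (u x : ℂ)) 2 (volume.restrict D)) atTop (𝓝 0) := by
    have h1 := tendsto_iff_edist_tendsto_0.1 hv
    refine tendsto_of_tendsto_of_tendsto_of_le_of_le tendsto_const_nhds h1 (fun _ => zero_le)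
      fun n => ?_
    have h2 : edist (inclusionMap D (v n)) hu.toLp =
        eLpNorm ((v n : EuclideanSpace ℝ (Fin d) → ℝ) - u) 2 volume :=
      Lp.edist_toLp_toLp _ _ (realTest.memLp (v n).2 2) hu
    dsimp only
    rw [h2]
    refine (eLpNorm_mono fun x => ?_).trans (eLpNorm_restrict_le _ _ _ _)
    simp only [Pi.sub_apply, ← Complex.ofReal_sub, Complex.norm_real, le_refl]
  have hconvG : Tendsto (fun n => eLpNorm (classicalGradient (fun x =>
      ((v n : EuclideanSpace ℝ (Fin d) → ℝ) x : ℂ)) - ⇑G) 2 (volume.restrict D)) atTop (𝓝 0) := by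
    have h1 := tendsto_iff_edist_tendsto_0.1 hG
    refine h1.congr fun n => ?_
    rw [Lp.edist_def]
    refine eLpNorm_congr_ae ?_
    filter_upwards [(hvg n).coeFn_toLp] with x hx
    simp only [Pi.sub_apply]
    congr 1
  have hGm : MemLp (⇑G) 2 (volume.restrict D) := Lp.memLp G
  have hweak : IsWeakGradient D (fun x => (u x : ℂ)) G := by
    refine ⟨locallyIntegrableOn_of_memLp_two hD huc, locallyIntegrableOn_of_memLp_two hD hGm,
      fun φ hφ i => ?_⟩
    have hφm : MemLp φ 2 (volume.restrict D) :=
      hφ.1.continuous.memLp_of_hasCompactSupport hφ.2.1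
    have hφg : MemLp (fun x => classicalGradient φ x i) 2 (volume.restrict D) :=
      (memLp_classicalGradient hφ 2 _).continuousLinearMap_comp
        (EuclideanSpace.proj (𝕜 := ℂ) i : EuclideanSpace ℂ (Fin d) →L[ℂ] ℂ)
    have hcomp : ∀ {g : EuclideanSpace ℝ (Fin d) → EuclideanSpace ℂ (Fin d)},
        MemLp g 2 (volume.restrict D) → MemLp (fun x => g x i) 2 (volume.restrict D) := fun hg =>
      hg.continuousLinearMap_comp
        (EuclideanSpace.proj (𝕜 := ℂ) i : EuclideanSpace ℂ (Fin d) →L[ℂ] ℂ)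
    have h1 := tendsto_integral_mul_of_tendsto_eLpNorm hvc huc hφg hconv
    have h2 := (tendsto_integral_mul_of_tendsto_eLpNorm (fun n => hcomp (hvg n)) (hcomp hGm) hφm
      (tendsto_of_tendsto_of_tendsto_of_le_of_le tendsto_const_nhds hconvG (fun _ => zero_le)
        fun n => eLpNorm_mono fun x => PiLp.norm_apply_le (classicalGradient (fun x =>
          ((v n : EuclideanSpace ℝ (Fin d) → ℝ) x : ℂ)) x - G x) i)).neg
    refine tendsto_nhds_unique h1 (h2.congr fun n => ?_)
    exact (integral_mul_classicalGradient (hvt n) hφ i).symm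
  have hae := hweak.ae_eq hDo (isWeakGradient_weakGradient ⟨_, hweak⟩)
  refine ⟨⟨⟨huc, G, hweak, hGm⟩, fun n x => ((v n : EuclideanSpace ℝ (Fin d) → ℝ) x : ℂ), hvt,
    hconv, hconvG.congr fun n => eLpNorm_congr_ae ?_⟩, ?_⟩
  · filter_upwards [hae] with x hx
    rw [Pi.sub_apply, hx]
  · rw [← eLpNorm_congr_ae hae]
    rw [Lp.norm_def] at hGC
    exact (ENNReal.toReal_le_toReal hGm.2.ne hC).1 hGC

end WeakGradient

/-! ### The Sobolev inequality and almost everywhere approximation -/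

section Sobolev

variable {d : ℕ} {D : Set (EuclideanSpace ℝ (Fin d))}

/-- On the line, the supremum of a test function is bounded by the integral of its derivative. -/
theorem enorm_le_lintegral_fderiv_of_dim_one {D : Set (EuclideanSpace ℝ (Fin 1))}
    {f : EuclideanSpace ℝ (Fin 1) → ℝ} (hf : f ∈ realTest D) (x : EuclideanSpace ℝ (Fin 1)) :
    ‖f x‖ₑ ≤ ∫⁻ y, ‖fderiv ℝ f y‖ₑ := by
  let e : ℝ ≃ₗᵢ[ℝ] EuclideanSpace ℝ (Fin 1) := (OrthonormalBasis.singleton (Fin 1) ℝ).repr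
  have hmp : MeasurePreserving e volume volume := e.measurePreserving
  have hg : ContDiff ℝ 1 (f ∘ e) := (hf.1.of_le (by simp)).comp e.contDiff
  have hgc : HasCompactSupport (f ∘ e) := hf.2.1.comp_homeomorph e.toHomeomorph
  have h1 := hgc.enorm_le_lintegral_Ici_deriv hg (e.symm x)
  rw [Function.comp_apply, e.apply_symm_apply] at h1
  refine h1.trans ((setLIntegral_le_lintegral _ _).trans ?_)
  rw [← hmp.lintegral_comp_emb e.toHomeomorph.measurableEmbedding]
  refine lintegral_mono fun t => ?_
  have h2 : HasDerivAt (f ∘ e) (fderiv ℝ f (e t) (e 1)) t := by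
    have h3 : HasDerivAt e (e 1) t := e.toContinuousLinearEquiv.toContinuousLinearMap.hasDerivAt
    exact ((realTest.differentiable hf) (e t)).hasFDerivAt.comp_hasDerivAt t h3
  rw [h2.deriv]
  refine (ContinuousLinearMap.le_opENorm _ _).trans_eq ?_
  have : ‖e 1‖ₑ = 1 := by
    rw [← ofReal_norm, e.norm_map]; simp
  rw [this, mul_one]

theorem eLpNorm_fderiv_le_mul_eLpNorm_two {f : EuclideanSpace ℝ (Fin d) → ℝ} (hf : f ∈ realTest D)
    {p : ℝ≥0∞} (hp : p ≤ 2) :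
    eLpNorm (fderiv ℝ f) p volume ≤
      eLpNorm (fderiv ℝ f) 2 volume * volume D ^ (1 / p.toReal - 1 / (2 : ℝ≥0∞).toReal) := by
  rw [← realTest.eLpNorm_fderiv_restrict hf p, ← realTest.eLpNorm_fderiv_restrict hf 2]
  refine (eLpNorm_le_eLpNorm_mul_rpow_measure_univ hp
    (realTest.continuous_fderiv hf).aestronglyMeasurable).trans_eq ?_
  rw [Measure.restrict_apply_univ]

/-- The Sobolev inequality `‖f‖₆ ≤ K ‖∇f‖₂` on bounded domains in dimension at most three. -/
theorem exists_eLpNorm_six_le (hd1 : 1 ≤ d) (hd3 : d ≤ 3) (hD : Bornology.IsBounded D) :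
    ∃ K : ℝ≥0∞, K ≠ ⊤ ∧ ∀ f ∈ realTest D,
      eLpNorm f 6 volume ≤ K * eLpNorm (fderiv ℝ f) 2 volume := by
  have hvol : volume D ≠ ⊤ := hD.measure_lt_top.ne
  have hsupp : ∀ f ∈ realTest D, Function.support f ⊆ D :=
    fun f hf => (subset_tsupport f).trans hf.2.2
  interval_cases d
  · refine ⟨volume D ^ (1 / (1 : ℝ≥0∞).toReal - 1 / (2 : ℝ≥0∞).toReal) *
      volume D ^ (6 : ℝ≥0∞).toReal⁻¹, ?_, fun f hf => ?_⟩
    · exact ENNReal.mul_ne_top (ENNReal.rpow_ne_top_of_nonneg (by norm_num) hvol)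
        (ENNReal.rpow_ne_top_of_nonneg (by norm_num) hvol)
    · have h1 : ∀ x, ‖f x‖ₑ ≤ eLpNorm (fderiv ℝ f) 2 volume *
          volume D ^ (1 / (1 : ℝ≥0∞).toReal - 1 / (2 : ℝ≥0∞).toReal) := fun x => by
        refine le_trans ?_ (eLpNorm_fderiv_le_mul_eLpNorm_two hf (p := 1) (by norm_num))
        rw [eLpNorm_one_eq_lintegral_enorm]
        exact enorm_le_lintegral_fderiv_of_dim_one hf x
      rw [← eLpNorm_restrict_eq_of_support_subset (hsupp f hf)]
      refine (eLpNorm_le_of_ae_enorm_bound (Eventually.of_forall h1)).trans_eq ?_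
      rw [Measure.restrict_apply_univ, smul_eq_mul]
      ring
  · have hp : ((3 / 2 : NNReal) : ℝ≥0∞) ≤ 2 := by
      rw [show (2 : ℝ≥0∞) = ((2 : NNReal) : ℝ≥0∞) by norm_num, ENNReal.coe_le_coe]
      rw [← NNReal.coe_le_coe]; norm_num
    refine ⟨eLpNormLESNormFDerivOfLeConst ℝ volume D (3 / 2) 6 *
      volume D ^ (1 / ((3 / 2 : NNReal) : ℝ≥0∞).toReal - 1 / (2 : ℝ≥0∞).toReal), ?_,
      fun f hf => ?_⟩
    · exact ENNReal.mul_ne_top ENNReal.coe_ne_top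
        (ENNReal.rpow_ne_top_of_nonneg (by norm_num) hvol)
    · have h1 := eLpNorm_le_eLpNorm_fderiv_of_le volume (hf.1.of_le (by simp)) (hsupp f hf)
        (p := 3 / 2) (q := 6) (by rw [← NNReal.coe_le_coe]; norm_num)
        (by rw [← NNReal.coe_lt_coe]; simp; norm_num) (by simp; norm_num) hD
      refine h1.trans ?_
      rw [mul_assoc]
      gcongr
      rw [mul_comm]
      exact eLpNorm_fderiv_le_mul_eLpNorm_two hf hp
  · refine ⟨eLpNormLESNormFDerivOfLeConst ℝ volume D 2 6, ENNReal.coe_ne_top, fun f hf => ?_⟩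
    exact eLpNorm_le_eLpNorm_fderiv_of_le volume (hf.1.of_le (by simp)) (hsupp f hf)
        (p := 2) (q := 6) (by rw [← NNReal.coe_le_coe]; norm_num)
        (by rw [← NNReal.coe_lt_coe]; simp; norm_num) (by simp; norm_num) hD

/-- A function with a relaxed gradient bound is the almost everywhere limit of a sequence of test
functions whose gradients are bounded in `L²`. -/
theorem GradNormLE.exists_seq {u : EuclideanSpace ℝ (Fin d) → ℝ} {C : ℝ≥0∞}
    (hu : AEStronglyMeasurable u volume) (h : GradNormLE D u C) :
    ∃ f : ℕ → EuclideanSpace ℝ (Fin d) → ℝ, (∀ n, f n ∈ realTest D) ∧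
      (∀ n, eLpNorm (fderiv ℝ (f n)) 2 volume ≤ C + 1) ∧
      ∀ᵐ x, Tendsto (fun n => f n x) atTop (𝓝 (u x)) := by
  have he : ∀ n : ℕ, ((n : ℝ≥0∞) + 1)⁻¹ ≠ 0 := fun n => by simp
  have he1 : ∀ n : ℕ, ((n : ℝ≥0∞) + 1)⁻¹ ≤ 1 := fun n => by simp
  have he0 : Tendsto (fun n : ℕ => ((n : ℝ≥0∞) + 1)⁻¹) atTop (𝓝 0) := by
    have := (ENNReal.tendsto_inv_nat_nhds_zero).comp (tendsto_add_atTop_nat 1)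
    refine this.congr fun n => ?_
    simp
  choose f hf hfu hfC using fun n : ℕ => h _ (he n)
  have hm : TendstoInMeasure volume f atTop u := by
    refine tendstoInMeasure_of_tendsto_eLpNorm (p := 2) (by norm_num)
      (fun n => (realTest.continuous (hf n)).aestronglyMeasurable) hu ?_
    exact tendsto_of_tendsto_of_tendsto_of_le_of_le tendsto_const_nhds he0 (fun _ => zero_le) hfu
  obtain ⟨φ, -, hφ⟩ := hm.exists_seq_tendsto_ae
  exact ⟨fun n => f (φ n), fun n => hf _, fun n => (hfC _).trans (by gcongr; exact he1 _), hφ⟩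

theorem GradNormLE.ae_eq_zero {u : EuclideanSpace ℝ (Fin d) → ℝ} {C : ℝ≥0∞}
    (hu : AEStronglyMeasurable u volume) (h : GradNormLE D u C) : ∀ᵐ x, x ∉ D → u x = 0 := by
  obtain ⟨f, hf, -, hlim⟩ := h.exists_seq hu
  filter_upwards [hlim] with x hx hxD
  exact tendsto_nhds_unique hx (by simp [realTest.eq_zero (hf _) hxD])

theorem GradNormLE.memLp_six (hd1 : 1 ≤ d) (hd3 : d ≤ 3) (hD : Bornology.IsBounded D)
    {u : EuclideanSpace ℝ (Fin d) → ℝ} {C : ℝ≥0∞} (hu : AEStronglyMeasurable u volume)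
    (hC : C ≠ ⊤) (h : GradNormLE D u C) : MemLp u 6 volume := by
  obtain ⟨K, hK, hsob⟩ := exists_eLpNorm_six_le hd1 hd3 hD
  obtain ⟨f, hf, hfC, hlim⟩ := h.exists_seq hu
  refine ⟨hu, lt_of_le_of_lt (Lp.eLpNorm_lim_le_liminf_eLpNorm
    (fun n => (realTest.continuous (hf n)).aestronglyMeasurable) u hlim)
    (lt_of_le_of_lt (b := K * (C + 1)) ?_ (by finiteness))⟩
  refine liminf_le_of_le (by isBoundedDefault) fun b hb => ?_
  obtain ⟨n, hn⟩ := hb.exists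
  exact hn.trans ((hsob _ (hf n)).trans (by gcongr; exact hfC n))

end Sobolev

/-! ### From the relaxed energy to the energy -/

section Energy

variable {d : ℕ} {D : Set (EuclideanSpace ℝ (Fin d))}

theorem H10.aestronglyMeasurable_indicator_norm (hDm : MeasurableSet D)
    {Φ : EuclideanSpace ℝ (Fin d) → ℂ} (hΦ : Φ ∈ H10 D) :
    AEStronglyMeasurable (D.indicator fun x => ‖Φ x‖) volume :=
  (aestronglyMeasurable_indicator_iff hDm).2 (H10.aestronglyMeasurable hΦ).norm

theorem H10.memLp_six (hd1 : 1 ≤ d) (hd3 : d ≤ 3) (hD : Bornology.IsBounded D)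
    (hDm : MeasurableSet D) {Φ : EuclideanSpace ℝ (Fin d) → ℂ} (hΦ : Φ ∈ H10 D) :
    MemLp Φ 6 (volume.restrict D) := by
  have h1 := (gradNormLE_norm hD hDm hΦ).memLp_six hd1 hd3 hD
    (H10.aestronglyMeasurable_indicator_norm hDm hΦ) (H10.memLp_weakGradient hΦ).2.ne
  rw [memLp_indicator_iff_restrict hDm] at h1
  exact (memLp_norm_iff (H10.aestronglyMeasurable hΦ)).1 h1

/-- On `H¹₀`, all terms of the energy are finite; adding `3/32` times the mass completes the
square. -/
theorem energy_add_mass (hd1 : 1 ≤ d) (hd3 : d ≤ 3) (hD : Bornology.IsBounded D)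
    (hDm : MeasurableSet D) {Φ : EuclideanSpace ℝ (Fin d) → ℂ} (hΦ : Φ ∈ H10 D) :
    ENNReal.ofReal (energy D Φ + 3 / 32 * ∫ x in D, ‖Φ x‖ ^ 2) =
      eLpNorm (weakGradient D Φ) 2 (volume.restrict D) ^ 2 / 2 +
        ∫⁻ x in D, ENNReal.ofReal (wellDensity ‖Φ x‖) ∧
    0 ≤ energy D Φ + 3 / 32 * ∫ x in D, ‖Φ x‖ ^ 2 := by
  have : IsFiniteMeasure (volume.restrict D) := ⟨by simpa using hD.measure_lt_top⟩
  have h6 := H10.memLp_six hd1 hd3 hD hDm hΦ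
  have i6 : Integrable (fun x => ‖Φ x‖ ^ 6) (volume.restrict D) :=
    h6.integrable_norm_pow (p := 6) (by norm_num)
  have i4 : Integrable (fun x => ‖Φ x‖ ^ 4) (volume.restrict D) :=
    (h6.mono_exponent (by norm_num : ((4 : ℕ) : ℝ≥0∞) ≤ 6)).integrable_norm_pow (by norm_num)
  have i2 : Integrable (fun x => ‖Φ x‖ ^ 2) (volume.restrict D) :=
    hΦ.1.1.integrable_norm_pow (p := 2) (by norm_num)
  have hW := H10.memLp_weakGradient hΦ
  have iW : Integrable (fun x => ‖weakGradient D Φ x‖ ^ 2) (volume.restrict D) :=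
    hW.integrable_norm_pow (p := 2) (by norm_num)
  have iwell : Integrable (fun x => wellDensity ‖Φ x‖) (volume.restrict D) := by
    simp_rw [wellDensity_eq]
    exact ((i6.const_mul _).sub (i4.const_mul _)).add (i2.const_mul _)
  have hsum : energy D Φ + 3 / 32 * ∫ x in D, ‖Φ x‖ ^ 2 =
      1 / 2 * (∫ x in D, ‖weakGradient D Φ x‖ ^ 2) + ∫ x in D, wellDensity ‖Φ x‖ := by
    simp_rw [wellDensity_eq]
    rw [integral_add (by exact (i6.const_mul _).sub (i4.const_mul _)) (i2.const_mul _),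
      integral_sub (i6.const_mul _) (i4.const_mul _), integral_const_mul, integral_const_mul,
      integral_const_mul, energy]
    ring
  have n1 : 0 ≤ 1 / 2 * ∫ x in D, ‖weakGradient D Φ x‖ ^ 2 :=
    mul_nonneg (by norm_num) (integral_nonneg fun x => by positivity)
  have n2 : 0 ≤ ∫ x in D, wellDensity ‖Φ x‖ := integral_nonneg fun x => wellDensity_nonneg _
  refine ⟨?_, hsum ▸ add_nonneg n1 n2⟩
  rw [hsum, ENNReal.ofReal_add n1 n2,
    ofReal_integral_eq_lintegral_ofReal iwell (Eventually.of_forall fun x => wellDensity_nonneg _),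
    ENNReal.ofReal_mul (by norm_num),
    ofReal_integral_eq_lintegral_ofReal iW (Eventually.of_forall fun x => by positivity),
    eLpNorm_two_sq]
  congr 1
  rw [ENNReal.div_eq_inv_mul, one_div, ENNReal.ofReal_inv_of_pos (by norm_num)]
  congr 1
  · simp
  · refine lintegral_congr fun x => ?_
    rw [ENNReal.ofReal_pow (norm_nonneg _), ofReal_norm]

theorem relaxedEnergy_indicator_norm_le (hd1 : 1 ≤ d) (hd3 : d ≤ 3) (hD : Bornology.IsBounded D)
    (hDm : MeasurableSet D) {Φ : EuclideanSpace ℝ (Fin d) → ℂ} (hΦ : Φ ∈ H10 D) :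
    relaxedEnergy D (D.indicator fun x => ‖Φ x‖) ≤
      ENNReal.ofReal (energy D Φ + 3 / 32 * ∫ x in D, ‖Φ x‖ ^ 2) := by
  rw [(energy_add_mass hd1 hd3 hD hDm hΦ).1, relaxedEnergy]
  have hg := (gradNorm_le_iff (H10.memLp_weakGradient hΦ).2.ne).2 (gradNormLE_norm hD hDm hΦ)
  refine add_le_add (by gcongr) ?_
  rw [← lintegral_indicator hDm]
  refine lintegral_mono fun x => ?_
  by_cases hx : x ∈ D <;> simp [hx, wellDensity]

theorem le_relaxedEnergy (hd1 : 1 ≤ d) (hd3 : d ≤ 3) (hDo : IsOpen D)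
    (hD : Bornology.IsBounded D) {u : EuclideanSpace ℝ (Fin d) → ℝ} (hu : MemLp u 2 volume)
    (hfin : relaxedEnergy D u ≠ ⊤) :
    (fun x => (u x : ℂ)) ∈ H10 D ∧
      ENNReal.ofReal (energy D (fun x => (u x : ℂ)) + 3 / 32 * ∫ x in D, ‖(u x : ℂ)‖ ^ 2) ≤
        relaxedEnergy D u := by
  have hgfin : gradNorm D u ≠ ⊤ :=
    ne_top_of_le_ne_top (by finiteness) (gradNorm_le_of_relaxedEnergy_le le_rfl)
  obtain ⟨h1, h2⟩ := mem_H10_of_gradNormLE hDo hD hu hgfin ((gradNorm_le_iff hgfin).1 le_rfl)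
  refine ⟨h1, ?_⟩
  rw [(energy_add_mass hd1 hd3 hD hDo.measurableSet h1).1, relaxedEnergy]
  refine add_le_add (by gcongr) ?_
  refine (setLIntegral_le_lintegral _ _).trans_eq (lintegral_congr fun x => ?_)
  rw [Complex.norm_real, Real.norm_eq_abs]
  simp [wellDensity]

theorem relaxedEnergy_ne_top_of_realTest {f : EuclideanSpace ℝ (Fin d) → ℝ}
    (hf : f ∈ realTest D) : relaxedEnergy D f ≠ ⊤ := by
  have h1 : gradNorm D f ≠ ⊤ := ne_top_of_le_ne_top (realTest.memLp_fderiv hf 2).2.ne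
    (sInf_le (gradNormLE_of_realTest hf))
  have h2 : Integrable (fun x => wellDensity (f x)) volume := by
    refine (continuous_wellDensity.comp (realTest.continuous hf)).integrable_of_hasCompactSupport ?_
    exact hf.2.1.comp_left (by simp [wellDensity])
  have h3 := h2.lintegral_lt_top
  exact ENNReal.add_ne_top.2 ⟨by finiteness, h3.ne⟩

/-- The mass of an element of `L²`, as the integral in the constraint. -/
theorem norm_eq_sqrt_iff {α F : Type*} [MeasurableSpace α] [NormedAddCommGroup F] {μ : Measure α}
    {g : α → F} (hg : MemLp g 2 μ) {N : ℝ} (hN : 0 ≤ N) :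
    ‖hg.toLp‖ = √N ↔ ∫ x, ‖g x‖ ^ 2 ∂μ = N := by
  have h1 : ‖hg.toLp‖ ^ 2 = ∫ x, ‖g x‖ ^ 2 ∂μ := by
    rw [Lp.norm_toLp, ← ENNReal.toReal_pow, eLpNorm_two_sq,
      integral_eq_lintegral_of_nonneg_ae (Eventually.of_forall fun x => sq_nonneg _)
      (by exact hg.1.norm.pow 2)]
    congr 1
    refine lintegral_congr fun x => ?_
    rw [ENNReal.ofReal_pow (norm_nonneg _), ofReal_norm]
  rw [← h1, eq_comm, Real.sqrt_eq_iff_eq_sq hN (norm_nonneg _), eq_comm]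

theorem exists_competitor (hDo : IsOpen D) (hDn : D.Nonempty) {N : ℝ} (hN : 0 < N) :
    ∃ v : Lp ℝ 2 (volume : Measure (EuclideanSpace ℝ (Fin d))), 0 ≤ v ∧ ‖v‖ = √N ∧
      relaxedEnergy D v ≠ ⊤ := by
  obtain ⟨x, hx⟩ := hDn
  obtain ⟨f, hfD, hfc, hfs, hf01, hfx⟩ :=
    exists_contDiff_tsupport_subset (n := ⊤) (hDo.mem_nhds hx)
  have hf : f ∈ realTest D := ⟨hfs, hfc, hfD⟩
  set F := (realTest.memLp hf 2).toLp with hF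
  have hF0 : F ≠ 0 := by
    intro h
    have h1 := (realTest.memLp hf 2).coeFn_toLp
    rw [← hF, h] at h1
    have := (Continuous.ae_eq_iff_eq volume hfs.continuous continuous_zero).1
      (h1.symm.trans (Lp.coeFn_zero _ _ _))
    rw [this] at hfx
    simp at hfx
  have hFn : 0 < ‖F‖ := norm_pos_iff.2 hF0
  set c : ℝ := √N / ‖F‖ with hc
  have hc0 : 0 ≤ c := by positivity
  have hcf : c • f ∈ realTest D := (realTest D).smul_mem c hf
  refine ⟨(realTest.memLp hcf 2).toLp, ?_, ?_, ?_⟩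
  · rw [← Lp.coeFn_nonneg]
    filter_upwards [(realTest.memLp hcf 2).coeFn_toLp] with y hy
    rw [hy]
    exact mul_nonneg hc0 (hf01 ⟨y, rfl⟩).1
  · have : (realTest.memLp hcf 2).toLp = c • F := rfl
    rw [this, norm_smul, Real.norm_of_nonneg hc0, hc, div_mul_cancel₀ _ hFn.ne']
  · rw [relaxedEnergy_congr_ae (realTest.memLp hcf 2).coeFn_toLp]
    exact relaxedEnergy_ne_top_of_realTest hcf

/-- A function whose relaxed energy is finite and at most that of every non-negative function of
the same mass is a ground state. -/
theorem isGroundState_of_minimizer (hd1 : 1 ≤ d) (hd3 : d ≤ 3) (hDo : IsOpen D)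
    (hD : Bornology.IsBounded D) {N : ℝ} (hN : 0 ≤ N) {u : EuclideanSpace ℝ (Fin d) → ℝ}
    (hu : MemLp u 2 volume) (hun : ‖hu.toLp‖ = √N) (hfin : relaxedEnergy D u ≠ ⊤)
    (hmin : ∀ v : Lp ℝ 2 (volume : Measure (EuclideanSpace ℝ (Fin d))), 0 ≤ v → ‖v‖ = √N →
      relaxedEnergy D u ≤ relaxedEnergy D v) :
    IsGroundState D N fun x => (u x : ℂ) := by
  have hDm := hDo.measurableSet
  obtain ⟨hH, hE⟩ := le_relaxedEnergy hd1 hd3 hDo hD hu hfin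
  have hgfin : gradNorm D u ≠ ⊤ :=
    ne_top_of_le_ne_top (by finiteness) (gradNorm_le_of_relaxedEnergy_le le_rfl)
  have hmass : ∫ x in D, ‖(u x : ℂ)‖ ^ 2 = N := by
    rw [← (norm_eq_sqrt_iff hu hN).1 hun]
    simp_rw [Complex.norm_real]
    refine setIntegral_eq_integral_of_ae_compl_eq_zero ?_
    filter_upwards [((gradNorm_le_iff hgfin).1 le_rfl).ae_eq_zero hu.1] with x hx hxD
    simp [hx hxD]
  have hadm : (fun x => (u x : ℂ)) ∈ admissible D N := ⟨hH, hmass⟩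
  have hlow : ∀ Ψ ∈ admissible D N, energy D (fun x => (u x : ℂ)) ≤ energy D Ψ := by
    rintro Ψ ⟨hΨ, hΨN⟩
    have hv : MemLp (D.indicator fun x => ‖Ψ x‖) 2 volume :=
      (memLp_indicator_iff_restrict hDm).2 hΨ.1.1.norm
    have h1 := hmin hv.toLp (by
      rw [← Lp.coeFn_nonneg]
      filter_upwards [hv.coeFn_toLp] with x hx
      rw [hx]
      exact indicator_nonneg (fun _ _ => norm_nonneg _) x) (by
      rw [norm_eq_sqrt_iff hv hN, ← hΨN, ← integral_indicator hDm]
      congr 1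
      ext x
      by_cases hx : x ∈ D <;> simp [hx])
    rw [relaxedEnergy_congr_ae hv.coeFn_toLp] at h1
    have h2 := hE.trans (h1.trans (relaxedEnergy_indicator_norm_le hd1 hd3 hD hDm hΨ))
    rw [ENNReal.ofReal_le_ofReal_iff (energy_add_mass hd1 hd3 hD hDm hΨ).2, hmass, hΨN] at h2
    linarith
  have hleast : IsLeast (energy D '' admissible D N) (energy D fun x => (u x : ℂ)) :=
    ⟨⟨_, hadm, rfl⟩, by rintro _ ⟨Ψ, hΨ, rfl⟩; exact hlow Ψ hΨ⟩
  have heq : groundStateEnergy D N = energy D fun x => (u x : ℂ) := hleast.csInf_eq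
  exact ⟨hadm, heq.symm, fun Ψ hΨ => heq ▸ hlow Ψ hΨ⟩

end Energy

/-! ### Smooth truncations -/

section SmoothPositivePart

/-- A smooth approximation of the positive part `t ↦ max t 0` which vanishes for `t ≤ ε` and has
slope between `0` and `1`. -/
def smoothPos (ε t : ℝ) : ℝ := ∫ s in (0 : ℝ)..t, Real.smoothTransition (s / ε - 1)

theorem hasDerivAt_smoothPos (ε t : ℝ) :
    HasDerivAt (smoothPos ε) (Real.smoothTransition (t / ε - 1)) t := by
  have hc : Continuous fun s : ℝ => Real.smoothTransition (s / ε - 1) :=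
    Real.smoothTransition.continuous.comp (by fun_prop)
  exact intervalIntegral.integral_hasDerivAt_right (hc.intervalIntegrable _ _)
    (hc.stronglyMeasurableAtFilter _ _) hc.continuousAt

theorem contDiff_smoothPos (ε : ℝ) : ContDiff ℝ ∞ (smoothPos ε) := by
  rw [contDiff_infty_iff_deriv]
  refine ⟨fun t => (hasDerivAt_smoothPos ε t).differentiableAt, ?_⟩
  have : deriv (smoothPos ε) = fun t => Real.smoothTransition (t / ε - 1) :=
    funext fun t => (hasDerivAt_smoothPos ε t).deriv
  rw [this]
  exact Real.smoothTransition.contDiff.comp (by fun_prop)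

theorem monotone_smoothPos (ε : ℝ) : Monotone (smoothPos ε) :=
  monotone_of_hasDerivAt_nonneg (hasDerivAt_smoothPos ε) fun _ => Real.smoothTransition.nonneg _

theorem smoothPos_eq_zero {ε t : ℝ} (hε : 0 < ε) (ht : t ≤ ε) : smoothPos ε t = 0 := by
  refine (intervalIntegral.integral_congr (g := fun _ => 0) fun s hs => ?_).trans (by simp)
  refine Real.smoothTransition.zero_of_nonpos ?_
  have h1 : s ≤ ε := hs.2.trans (max_le hε.le ht)
  rw [sub_nonpos, div_le_one hε]
  exact h1

theorem smoothPos_nonneg {ε : ℝ} (hε : 0 < ε) (t : ℝ) : 0 ≤ smoothPos ε t := by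
  rcases le_total t ε with h | h
  · rw [smoothPos_eq_zero hε h]
  · rw [← smoothPos_eq_zero hε le_rfl]
    exact monotone_smoothPos ε h

theorem smoothPos_le {ε : ℝ} (hε : 0 < ε) {t : ℝ} (ht : 0 ≤ t) : smoothPos ε t ≤ t := by
  have h : Monotone fun t => t - smoothPos ε t :=
    monotone_of_hasDerivAt_nonneg (fun t => (hasDerivAt_id t).sub (hasDerivAt_smoothPos ε t))
      fun t => sub_nonneg.2 (Real.smoothTransition.le_one _)
  have := h ht
  simp only [smoothPos_eq_zero hε hε.le] at this
  linarith

theorem sub_le_smoothPos {ε : ℝ} (hε : 0 < ε) (t : ℝ) : t - 2 * ε ≤ smoothPos ε t := by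
  rcases le_total t (2 * ε) with h | h
  · linarith [smoothPos_nonneg hε t]
  · have hd : ∀ s, HasDerivAt (fun t => smoothPos ε t - t)
        (Real.smoothTransition (s / ε - 1) - 1) s :=
      fun s => (hasDerivAt_smoothPos ε s).sub (hasDerivAt_id s)
    have hmono : MonotoneOn (fun t => smoothPos ε t - t) (Ici (2 * ε)) := by
      refine monotoneOn_of_deriv_nonneg (convex_Ici _)
        (fun s _ => (hd s).continuousAt.continuousWithinAt)
        (fun s _ => (hd s).differentiableAt.differentiableWithinAt) fun s hs => ?_
      rw [interior_Ici, mem_Ioi] at hs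
      rw [(hd s).deriv, Real.smoothTransition.one_of_one_le, sub_self]
      rw [le_sub_iff_add_le, le_div_iff₀ hε]
      linarith
    have := hmono (mem_Ici.2 le_rfl) (mem_Ici.2 h) h
    simp only at this
    linarith [smoothPos_nonneg hε (2 * ε)]

theorem abs_smoothPos_sub_max_le {ε : ℝ} (hε : 0 < ε) (t : ℝ) :
    |smoothPos ε t - max t 0| ≤ 2 * ε := by
  rcases le_total t 0 with h | h
  · rw [max_eq_right h, smoothPos_eq_zero hε (h.trans hε.le)]
    simp [hε.le]
  · rw [max_eq_left h, abs_le]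
    constructor <;> linarith [smoothPos_le hε h, sub_le_smoothPos hε t]

/-- A smooth even approximation of the absolute value, vanishing near zero. -/
def smoothAbs (ε t : ℝ) : ℝ := smoothPos ε t + smoothPos ε (-t)

theorem smoothAbs_neg (ε t : ℝ) : smoothAbs ε (-t) = smoothAbs ε t := by
  rw [smoothAbs, smoothAbs, neg_neg, add_comm]

theorem smoothAbs_eq_zero {ε t : ℝ} (hε : 0 < ε) (ht : |t| ≤ ε) : smoothAbs ε t = 0 := by
  rw [smoothAbs, smoothPos_eq_zero hε (le_of_abs_le ht),
    smoothPos_eq_zero hε ((neg_le_abs t).trans ht), add_zero]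

theorem abs_smoothAbs_sub_abs_le {ε : ℝ} (hε : 0 < ε) (t : ℝ) :
    |smoothAbs ε t - abs t| ≤ 2 * ε := by
  wlog h : 0 ≤ t generalizing t
  · have := this (-t) (by linarith)
    rwa [smoothAbs_neg, abs_neg] at this
  have h1 := abs_smoothPos_sub_max_le hε t
  rw [max_eq_left h] at h1
  rwa [smoothAbs, smoothPos_eq_zero hε (by linarith : -t ≤ ε), add_zero, abs_of_nonneg h]

/-- The derivative of `smoothAbs ε`. -/
def smoothSign (ε t : ℝ) : ℝ :=
  Real.smoothTransition (t / ε - 1) - Real.smoothTransition (-t / ε - 1)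

theorem hasDerivAt_smoothAbs (ε t : ℝ) : HasDerivAt (smoothAbs ε) (smoothSign ε t) t := by
  have h := (hasDerivAt_smoothPos ε (-t)).comp t (hasDerivAt_neg t)
  have h2 := (hasDerivAt_smoothPos ε t).add h
  rw [mul_neg_one, ← sub_eq_add_neg] at h2
  exact h2

theorem continuous_smoothSign (ε : ℝ) : Continuous (smoothSign ε) := by
  unfold smoothSign
  exact (Real.smoothTransition.continuous.comp (by fun_prop)).sub
    (Real.smoothTransition.continuous.comp (by fun_prop))

theorem smoothSign_neg (ε t : ℝ) : smoothSign ε (-t) = -smoothSign ε t := by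
  simp [smoothSign]

theorem abs_smoothSign_le (ε t : ℝ) : |smoothSign ε t| ≤ 1 := by
  have h1 := Real.smoothTransition.nonneg (t / ε - 1)
  have h2 := Real.smoothTransition.nonneg (-t / ε - 1)
  have h3 := Real.smoothTransition.le_one (t / ε - 1)
  have h4 := Real.smoothTransition.le_one (-t / ε - 1)
  rw [smoothSign, abs_le]
  constructor <;> linarith

theorem contDiff_smoothAbs (ε : ℝ) : ContDiff ℝ ∞ (smoothAbs ε) :=
  (contDiff_smoothPos ε).add ((contDiff_smoothPos ε).comp contDiff_neg)

variable {d : ℕ} {D : Set (EuclideanSpace ℝ (Fin d))}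

theorem norm_fderiv_smoothPos_comp_le (ε : ℝ) {f : EuclideanSpace ℝ (Fin d) → ℝ}
    {x : EuclideanSpace ℝ (Fin d)} (hf : DifferentiableAt ℝ f x) :
    ‖fderiv ℝ (fun y => smoothPos ε (f y)) x‖ ≤ ‖fderiv ℝ f x‖ := by
  have h : HasFDerivAt (fun y => smoothPos ε (f y)) _ x :=
    (hasDerivAt_smoothPos ε (f x)).comp_hasFDerivAt x hf.hasFDerivAt
  rw [h.fderiv, norm_smul, Real.norm_of_nonneg (Real.smoothTransition.nonneg _)]
  exact mul_le_of_le_one_left (norm_nonneg _) (Real.smoothTransition.le_one _)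

/-- Non-negative functions can be approximated by non-negative test functions. -/
theorem GradNormLE.exists_nonneg (hD : Bornology.IsBounded D)
    {u : EuclideanSpace ℝ (Fin d) → ℝ} {C : ℝ≥0∞} (hu : AEStronglyMeasurable u volume)
    (hu0 : ∀ᵐ x, 0 ≤ u x) (h : GradNormLE D u C) {η : ℝ≥0∞} (hη : η ≠ 0) :
    ∃ f ∈ realTest D, (∀ x, 0 ≤ f x) ∧ eLpNorm (fun x => f x - u x) 2 volume ≤ η ∧
      eLpNorm (fderiv ℝ f) 2 volume ≤ C + η := by
  have hη2 := (ENNReal.half_pos hη).ne'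
  obtain ⟨f, hf, h1, h2⟩ := h _ hη2
  obtain ⟨δ, hδ, hsmall⟩ := exists_pos_forall_eLpNorm_le hD hη2
  have hε : 0 < δ / 2 := by positivity
  have hcont := realTest.continuous hf
  have hsub : Function.support (fun x => smoothPos (δ / 2) (f x)) ⊆ Function.support f :=
    fun x hx h => hx (by simp [h, smoothPos_eq_zero hε hε.le])
  have hg : (fun x => smoothPos (δ / 2) (f x)) ∈ realTest D :=
    ⟨(contDiff_smoothPos _).comp hf.1, hf.2.1.mono hsub, (closure_mono hsub).trans hf.2.2⟩
  refine ⟨_, hg, fun x => smoothPos_nonneg hε _, ?_, ?_⟩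
  · have h3 : eLpNorm (fun x => smoothPos (δ / 2) (f x) - max (f x) 0) 2 volume ≤ η / 2 := by
      refine hsmall _ (fun x => ?_) fun x hx => ?_
      · exact (abs_smoothPos_sub_max_le hε _).trans (by linarith)
      · simp [realTest.eq_zero hf hx, smoothPos_eq_zero hε hε.le]
    have h4 : eLpNorm (fun x => max (f x) 0 - u x) 2 volume ≤ η / 2 := by
      refine (eLpNorm_mono_ae ?_).trans h1
      filter_upwards [hu0] with x hx
      have := abs_max_sub_max_le_abs (f x) (u x) 0
      rwa [max_eq_left hx] at this
    calc eLpNorm (fun x => smoothPos (δ / 2) (f x) - u x) 2 volume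
        = eLpNorm ((fun x => smoothPos (δ / 2) (f x) - max (f x) 0) +
            fun x => max (f x) 0 - u x) 2 volume := by congr 1; ext x; simp
      _ ≤ _ := eLpNorm_add_le ((realTest.continuous hg).sub (by fun_prop)).aestronglyMeasurable
          ((by fun_prop : Continuous fun x => max (f x) 0).aestronglyMeasurable.sub hu)
          (by norm_num)
      _ ≤ η / 2 + η / 2 := add_le_add h3 h4
      _ = η := ENNReal.add_halves η
  · refine (eLpNorm_mono fun x => ?_).trans (h2.trans (by gcongr; exact ENNReal.half_le_self))
    exact norm_fderiv_smoothPos_comp_le _ ((realTest.differentiable hf) x)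

end SmoothPositivePart

/-! ### Reflections -/

section Reflection

variable {d : ℕ}

/-- The affine function that is positive on the half-space `⟪e, x⟫ < c`. -/
def depth (e : EuclideanSpace ℝ (Fin d)) (c : ℝ) (x : EuclideanSpace ℝ (Fin d)) : ℝ :=
  c - inner ℝ e x

/-- The reflection across the hyperplane `⟪e, x⟫ = c`, for a unit vector `e`. -/
def reflect (e : EuclideanSpace ℝ (Fin d)) (c : ℝ) (x : EuclideanSpace ℝ (Fin d)) :
    EuclideanSpace ℝ (Fin d) := x + (2 * depth e c x) • e

variable {e : EuclideanSpace ℝ (Fin d)} {c : ℝ}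

theorem continuous_depth : Continuous (depth e c) := by
  unfold depth; fun_prop

theorem contDiff_reflect : ContDiff ℝ ∞ (reflect e c) := by
  unfold reflect depth
  exact contDiff_id.add ((contDiff_const.mul (contDiff_const.sub
    (contDiff_const.inner ℝ contDiff_id))).smul contDiff_const)

theorem depth_reflect (he : ‖e‖ = 1) (x : EuclideanSpace ℝ (Fin d)) :
    depth e c (reflect e c x) = -depth e c x := by
  simp only [depth, reflect, inner_add_right, real_inner_smul_right, real_inner_self_eq_norm_sq, he]
  ring

theorem reflect_reflect (he : ‖e‖ = 1) (x : EuclideanSpace ℝ (Fin d)) :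
    reflect e c (reflect e c x) = x := by
  rw [reflect, depth_reflect he, reflect]
  module

theorem reflect_eq_self {x : EuclideanSpace ℝ (Fin d)} (h : depth e c x = 0) :
    reflect e c x = x := by
  simp [reflect, h]

theorem norm_sub_reflect_sq (he : ‖e‖ = 1) (x z : EuclideanSpace ℝ (Fin d)) :
    ‖z - reflect e c x‖ ^ 2 = ‖z - x‖ ^ 2 + 4 * depth e c x * depth e c z := by
  have h1 : z - reflect e c x = (z - x) - (2 * depth e c x) • e := by
    rw [reflect]; abel
  rw [h1, norm_sub_sq_real, real_inner_smul_right, norm_smul, he, mul_one, Real.norm_eq_abs, sq_abs,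
    real_inner_comm, inner_sub_right]
  simp only [depth]
  ring

theorem norm_reflect_sub_reflect (he : ‖e‖ = 1) (x z : EuclideanSpace ℝ (Fin d)) :
    ‖reflect e c z - reflect e c x‖ = ‖z - x‖ := by
  rw [← sq_eq_sq₀ (norm_nonneg _) (norm_nonneg _), norm_sub_reflect_sq he, norm_sub_rev,
    norm_sub_reflect_sq he, depth_reflect he, norm_sub_rev]
  ring

theorem measurePreserving_reflect (he : ‖e‖ = 1) :
    MeasurePreserving (reflect e c) volume volume := by
  have h1 := ((ℝ ∙ e)ᗮ.reflection).measurePreserving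
  have h2 := measurePreserving_add_right (volume : Measure (EuclideanSpace ℝ (Fin d)))
    ((2 * c) • e)
  have h3 : reflect e c = (fun x => x + (2 * c) • e) ∘ (ℝ ∙ e)ᗮ.reflection := by
    ext1 x
    rw [Function.comp_apply, Submodule.reflection_orthogonal_apply,
      Submodule.reflection_singleton_apply]
    simp only [he, reflect, depth]
    norm_num
    module
  rw [h3]
  exact h2.comp h1

theorem measurable_reflect : Measurable (reflect e c) := contDiff_reflect.continuous.measurable

/-- `reflect` as a measurable equivalence. -/
def reflectEquiv (he : ‖e‖ = 1) (c : ℝ) :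
    EuclideanSpace ℝ (Fin d) ≃ᵐ EuclideanSpace ℝ (Fin d) where
  toFun := reflect e c
  invFun := reflect e c
  left_inv := reflect_reflect he
  right_inv := reflect_reflect he
  measurable_toFun := measurable_reflect
  measurable_invFun := measurable_reflect

theorem lintegral_comp_reflect (he : ‖e‖ = 1) (g : EuclideanSpace ℝ (Fin d) → ℝ≥0∞) :
    ∫⁻ x, g (reflect e c x) = ∫⁻ x, g x :=
  (measurePreserving_reflect he).lintegral_comp_emb (reflectEquiv he c).measurableEmbedding g

theorem integral_comp_reflect (he : ‖e‖ = 1) (g : EuclideanSpace ℝ (Fin d) → ℝ) :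
    ∫ x, g (reflect e c x) = ∫ x, g x :=
  (measurePreserving_reflect he).integral_comp (reflectEquiv he c).measurableEmbedding g

theorem norm_fderiv_reflect_le (he : ‖e‖ = 1) (x : EuclideanSpace ℝ (Fin d)) :
    ‖fderiv ℝ (reflect e c) x‖ ≤ 1 := by
  have : LipschitzWith 1 (reflect e c) := LipschitzWith.of_dist_le_mul fun x y => by
    rw [dist_eq_norm, dist_eq_norm, norm_reflect_sub_reflect he, NNReal.coe_one, one_mul]
  simpa using norm_fderiv_le_of_lipschitz ℝ this

theorem norm_lt_norm_reflect (he : ‖e‖ = 1) (hc : 0 < c) {x : EuclideanSpace ℝ (Fin d)}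
    (hx : 0 < depth e c x) : ‖x‖ < ‖reflect e c x‖ := by
  have h := norm_sub_reflect_sq (c := c) he x 0
  simp only [zero_sub, norm_neg] at h
  have h0 : depth e c 0 = c := by simp [depth]
  rw [h0] at h
  refine lt_of_pow_lt_pow_left₀ 2 (norm_nonneg _) ?_
  rw [h]
  have : 0 < 4 * depth e c x * c := by positivity
  linarith

end Reflection

/-! ### Polarization -/

section Polarization

variable {d : ℕ}

/-- The sign `1` on the half-space `⟪e, x⟫ < c` and `-1` elsewhere. -/
def side (e : EuclideanSpace ℝ (Fin d)) (c : ℝ) (x : EuclideanSpace ℝ (Fin d)) : ℝ :=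
  if 0 < depth e c x then 1 else -1

/-- The polarization of `u`: among the values of `u` at a point and its mirror image, the larger
one is put on the side `⟪e, x⟫ < c` of the mirror, and the smaller one on the other side. -/
def polarize (e : EuclideanSpace ℝ (Fin d)) (c : ℝ) (u : EuclideanSpace ℝ (Fin d) → ℝ)
    (x : EuclideanSpace ℝ (Fin d)) : ℝ :=
  (u x + u (reflect e c x)) / 2 + side e c x * |u x - u (reflect e c x)| / 2

/-- A version of `polarize` that preserves smoothness: since `smoothAbs` vanishes near zero, there
is no singularity at the mirror. -/
def smoothPolarize (ε : ℝ) (e : EuclideanSpace ℝ (Fin d)) (c : ℝ)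
    (f : EuclideanSpace ℝ (Fin d) → ℝ) (x : EuclideanSpace ℝ (Fin d)) : ℝ :=
  (f x + f (reflect e c x)) / 2 + side e c x * smoothAbs ε (f x - f (reflect e c x)) / 2

variable {e : EuclideanSpace ℝ (Fin d)} {c : ℝ}

theorem side_of_pos {x : EuclideanSpace ℝ (Fin d)} (h : 0 < depth e c x) : side e c x = 1 :=
  if_pos h

theorem side_of_nonpos {x : EuclideanSpace ℝ (Fin d)} (h : depth e c x ≤ 0) : side e c x = -1 :=
  if_neg h.not_gt

theorem abs_side (x : EuclideanSpace ℝ (Fin d)) : |side e c x| = 1 := by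
  unfold side; split_ifs <;> simp

theorem side_reflect (he : ‖e‖ = 1) {x : EuclideanSpace ℝ (Fin d)} (h : depth e c x ≠ 0) :
    side e c (reflect e c x) = -side e c x := by
  rcases h.lt_or_gt with h | h
  · rw [side_of_nonpos h.le, side_of_pos (by rw [depth_reflect he]; linarith), neg_neg]
  · rw [side_of_pos h, side_of_nonpos (by rw [depth_reflect he]; linarith)]

theorem measurable_side : Measurable (side e c) :=
  Measurable.ite (measurableSet_lt measurable_const continuous_depth.measurable) measurable_const
    measurable_const

theorem measurable_polarize {u : EuclideanSpace ℝ (Fin d) → ℝ} (hu : Measurable u) :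
    Measurable (polarize e c u) := by
  have h1 := hu.comp (measurable_reflect (e := e) (c := c))
  exact ((hu.add h1).div_const 2).add
    ((measurable_side.mul ((hu.sub h1).abs)).div_const 2)

theorem polarize_of_pos {u : EuclideanSpace ℝ (Fin d) → ℝ} {x : EuclideanSpace ℝ (Fin d)}
    (h : 0 < depth e c x) : polarize e c u x = max (u x) (u (reflect e c x)) := by
  rw [polarize, side_of_pos h]
  rcases le_total (u x) (u (reflect e c x)) with h' | h'
  · rw [max_eq_right h', abs_of_nonpos (sub_nonpos.2 h')]; ring
  · rw [max_eq_left h', abs_of_nonneg (sub_nonneg.2 h')]; ring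

theorem polarize_of_nonpos {u : EuclideanSpace ℝ (Fin d) → ℝ} {x : EuclideanSpace ℝ (Fin d)}
    (h : depth e c x ≤ 0) : polarize e c u x = min (u x) (u (reflect e c x)) := by
  rw [polarize, side_of_nonpos h]
  rcases le_total (u x) (u (reflect e c x)) with h' | h'
  · rw [min_eq_left h', abs_of_nonpos (sub_nonpos.2 h')]; ring
  · rw [min_eq_right h', abs_of_nonneg (sub_nonneg.2 h')]; ring

theorem polarize_nonneg {u : EuclideanSpace ℝ (Fin d) → ℝ} {x : EuclideanSpace ℝ (Fin d)}
    (h : 0 ≤ u x) (h' : 0 ≤ u (reflect e c x)) : 0 ≤ polarize e c u x := by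
  rcases le_or_gt (depth e c x) 0 with hx | hx
  · rw [polarize_of_nonpos hx]; exact le_min h h'
  · rw [polarize_of_pos hx]; exact h.trans (le_max_left _ _)

/-- Polarization only exchanges values between a point and its mirror image. -/
theorem polarize_reflect (he : ‖e‖ = 1) (u : EuclideanSpace ℝ (Fin d) → ℝ)
    (x : EuclideanSpace ℝ (Fin d)) :
    (polarize e c u x = u x ∧ polarize e c u (reflect e c x) = u (reflect e c x)) ∨
      (polarize e c u x = u (reflect e c x) ∧ polarize e c u (reflect e c x) = u x) := by
  rcases lt_trichotomy (depth e c x) 0 with h | h | h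
  · rw [polarize_of_nonpos h.le, polarize_of_pos (by rw [depth_reflect he]; linarith),
      reflect_reflect he]
    rcases le_total (u x) (u (reflect e c x)) with h' | h' <;> simp [h']
  · left
    simp [reflect_eq_self h, polarize_of_nonpos h.le]
  · rw [polarize_of_pos h, polarize_of_nonpos (by rw [depth_reflect he]; linarith),
      reflect_reflect he]
    rcases le_total (u x) (u (reflect e c x)) with h' | h' <;> simp [h']

theorem lintegral_comp_polarize (he : ‖e‖ = 1) {u : EuclideanSpace ℝ (Fin d) → ℝ}
    (hu : Measurable u) {F : ℝ → ℝ≥0∞} (hF : Measurable F) :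
    ∫⁻ x, F (polarize e c u x) = ∫⁻ x, F (u x) := by
  have hm := measurable_polarize (e := e) (c := c) hu
  have h1 : ∫⁻ x, (F (polarize e c u x) + F (polarize e c u (reflect e c x))) =
      ∫⁻ x, (F (u x) + F (u (reflect e c x))) := by
    refine lintegral_congr fun x => ?_
    rcases polarize_reflect (c := c) he u x with ⟨h1, h2⟩ | ⟨h1, h2⟩
    · rw [h1, h2]
    · rw [h1, h2, add_comm]
  rw [lintegral_add_left (f := fun x => F (polarize e c u x)) (hF.comp hm),
    lintegral_add_left (f := fun x => F (u x)) (hF.comp hu),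
    lintegral_comp_reflect he fun x => F (polarize e c u x),
    lintegral_comp_reflect he fun x => F (u x), ← two_mul, ← two_mul] at h1
  exact (ENNReal.mul_right_inj (by norm_num) (by norm_num)).1 h1

section Smooth

variable {f : EuclideanSpace ℝ (Fin d) → ℝ} {ε : ℝ}

theorem eventually_side_mul_smoothAbs (hε : 0 < ε) (hf : Continuous f)
    (x : EuclideanSpace ℝ (Fin d)) :
    ∀ᶠ y in 𝓝 x, side e c y * smoothAbs ε (f y - f (reflect e c y)) =
      side e c x * smoothAbs ε (f y - f (reflect e c y)) := by
  rcases lt_trichotomy (depth e c x) 0 with h | h | h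
  · filter_upwards [continuous_depth.continuousAt.eventually_lt_const h] with y hy
    rw [side_of_nonpos h.le, side_of_nonpos hy.le]
  · have hw : Continuous fun y => |f y - f (reflect e c y)| :=
      (hf.sub (hf.comp contDiff_reflect.continuous)).abs
    have h0 : |f x - f (reflect e c x)| < ε := by rw [reflect_eq_self h]; simpa
    filter_upwards [hw.continuousAt.eventually_lt_const h0] with y hy
    rw [smoothAbs_eq_zero hε hy.le, mul_zero, mul_zero]
  · filter_upwards [continuous_depth.continuousAt.eventually_const_lt h] with y hy
    rw [side_of_pos h, side_of_pos hy]

theorem smoothPolarize_eventuallyEq (hε : 0 < ε) (hf : Continuous f)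
    (x : EuclideanSpace ℝ (Fin d)) :
    smoothPolarize ε e c f =ᶠ[𝓝 x] fun y => (f y + f (reflect e c y)) / 2 +
      side e c x * smoothAbs ε (f y - f (reflect e c y)) / 2 := by
  filter_upwards [eventually_side_mul_smoothAbs (e := e) (c := c) hε hf x] with y hy
  rw [smoothPolarize, hy]

theorem contDiff_smoothPolarize (hε : 0 < ε) (hf : ContDiff ℝ ∞ f) :
    ContDiff ℝ ∞ (smoothPolarize ε e c f) := by
  rw [contDiff_iff_contDiffAt]
  intro x
  refine ContDiffAt.congr_of_eventuallyEq ?_ (smoothPolarize_eventuallyEq hε hf.continuous x)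
  have hg : ContDiff ℝ ∞ fun y => f (reflect e c y) := hf.comp contDiff_reflect
  exact (((hf.add hg).div_const 2).add
    ((contDiff_const.mul ((contDiff_smoothAbs ε).comp (hf.sub hg))).div_const 2)).contDiffAt

/-- The weight with which the gradients at a point and at its mirror image enter the gradient of
`smoothPolarize`. -/
def polarizeWeight (ε : ℝ) (e : EuclideanSpace ℝ (Fin d)) (c : ℝ)
    (f : EuclideanSpace ℝ (Fin d) → ℝ) (x : EuclideanSpace ℝ (Fin d)) : ℝ :=
  (1 + side e c x * smoothSign ε (f x - f (reflect e c x))) / 2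

theorem polarizeWeight_mem (x : EuclideanSpace ℝ (Fin d)) :
    polarizeWeight ε e c f x ∈ Icc (0 : ℝ) 1 := by
  have h : |side e c x * smoothSign ε (f x - f (reflect e c x))| ≤ 1 := by
    rw [abs_mul, abs_side, one_mul]
    exact abs_smoothSign_le _ _
  rw [abs_le] at h
  unfold polarizeWeight
  constructor <;> linarith [h.1, h.2]

theorem polarizeWeight_reflect (he : ‖e‖ = 1) (x : EuclideanSpace ℝ (Fin d)) :
    polarizeWeight ε e c f (reflect e c x) = polarizeWeight ε e c f x := by
  rcases eq_or_ne (depth e c x) 0 with h | h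
  · rw [reflect_eq_self h]
  · rw [polarizeWeight, polarizeWeight, side_reflect he h, reflect_reflect he,
      ← neg_sub (f x), smoothSign_neg, neg_mul_neg]

theorem measurable_polarizeWeight (hf : Continuous f) : Measurable (polarizeWeight ε e c f) := by
  have hg := hf.comp (contDiff_reflect (e := e) (c := c)).continuous
  exact ((measurable_side.mul ((continuous_smoothSign ε).comp (hf.sub hg)).measurable).const_add
    1).div_const 2

theorem norm_fderiv_smoothPolarize_sq_le (he : ‖e‖ = 1) (hε : 0 < ε) (hf : ContDiff ℝ ∞ f)
    (x : EuclideanSpace ℝ (Fin d)) :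
    ‖fderiv ℝ (smoothPolarize ε e c f) x‖ ^ 2 ≤
      polarizeWeight ε e c f x * ‖fderiv ℝ f x‖ ^ 2 +
        (1 - polarizeWeight ε e c f x) * ‖fderiv ℝ f (reflect e c x)‖ ^ 2 := by
  have hfd : Differentiable ℝ f := hf.differentiable (by simp)
  have hrd : Differentiable ℝ (reflect e c) := contDiff_reflect.differentiable (by simp)
  set g' := (fderiv ℝ f (reflect e c x)).comp (fderiv ℝ (reflect e c) x) with hg'
  have hg : HasFDerivAt (fun y => f (reflect e c y)) g' x :=
    (hfd (reflect e c x)).hasFDerivAt.comp x (hrd x).hasFDerivAt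
  have hgn : ‖g'‖ ≤ ‖fderiv ℝ f (reflect e c x)‖ := by
    refine (ContinuousLinearMap.opNorm_comp_le _ _).trans ?_
    exact mul_le_of_le_one_right (norm_nonneg _) (norm_fderiv_reflect_le he x)
  have hF := (hfd x).hasFDerivAt
  set w := f x - f (reflect e c x) with hw
  have hsub : HasFDerivAt (fun y => f y - f (reflect e c y)) (fderiv ℝ f x - g') x := hF.sub hg
  have hA : HasFDerivAt (fun y => smoothAbs ε (f y - f (reflect e c y)))
      (smoothSign ε w • (fderiv ℝ f x - g')) x := by
    have hd : HasDerivAt (smoothAbs ε) (smoothSign ε w) ((fun y => f y - f (reflect e c y)) x) :=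
      hasDerivAt_smoothAbs ε w
    exact hd.comp_hasFDerivAt x hsub
  have h1 : HasFDerivAt (smoothPolarize ε e c f)
      (polarizeWeight ε e c f x • fderiv ℝ f x + (1 - polarizeWeight ε e c f x) • g') x := by
    refine HasFDerivAt.congr_of_eventuallyEq ?_ (smoothPolarize_eventuallyEq hε hf.continuous x)
    have h2 := ((hF.add hg).const_mul (1 / 2)).add ((hA.const_mul (side e c x)).const_mul (1 / 2))
    have hD : polarizeWeight ε e c f x • fderiv ℝ f x + (1 - polarizeWeight ε e c f x) • g' =
        (1 / 2 : ℝ) • (fderiv ℝ f x + g') +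
          (1 / 2 : ℝ) • side e c x • smoothSign ε w • (fderiv ℝ f x - g') := by
      simp only [polarizeWeight, ← hw]
      module
    rw [hD]
    refine h2.congr_of_eventuallyEq (Eventually.of_forall fun y => ?_)
    simp only [Pi.add_apply]
    ring
  obtain ⟨h0, h01⟩ := polarizeWeight_mem (ε := ε) (e := e) (c := c) (f := f) x
  rw [h1.fderiv]
  set θ := polarizeWeight ε e c f x
  have h3 : ‖θ • fderiv ℝ f x + (1 - θ) • g'‖ ≤
      θ * ‖fderiv ℝ f x‖ + (1 - θ) * ‖fderiv ℝ f (reflect e c x)‖ := by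
    refine (norm_add_le _ _).trans ?_
    rw [norm_smul, norm_smul, Real.norm_of_nonneg h0, Real.norm_of_nonneg (sub_nonneg.2 h01)]
    gcongr
  refine (pow_le_pow_left₀ (norm_nonneg _) h3 2).trans ?_
  set a := ‖fderiv ℝ f x‖
  set b := ‖fderiv ℝ f (reflect e c x)‖
  nlinarith [mul_nonneg (mul_nonneg h0 (sub_nonneg.2 h01)) (sq_nonneg (a - b))]

/-- Polarization does not increase the Dirichlet integral: the gradients at mirror points are
replaced by convex combinations of each other with complementary weights. -/
theorem eLpNorm_fderiv_smoothPolarize_le (he : ‖e‖ = 1) (hε : 0 < ε) (hf : ContDiff ℝ ∞ f) :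
    eLpNorm (fderiv ℝ (smoothPolarize ε e c f)) 2 volume ≤ eLpNorm (fderiv ℝ f) 2 volume := by
  rw [← ENNReal.pow_le_pow_left_iff two_ne_zero, eLpNorm_two_sq, eLpNorm_two_sq]
  have hcd : Continuous (fderiv ℝ f) := hf.continuous_fderiv (by simp)
  let θ := polarizeWeight ε e c f
  have hθm : Measurable θ := measurable_polarizeWeight hf.continuous
  have hθ : ∀ x, 0 ≤ θ x ∧ θ x ≤ 1 := fun x => polarizeWeight_mem x
  have hrw : ∀ T : EuclideanSpace ℝ (Fin d) →L[ℝ] ℝ, ‖T‖ₑ ^ 2 = ENNReal.ofReal (‖T‖ ^ 2) :=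
    fun T => by rw [ENNReal.ofReal_pow (norm_nonneg _), ofReal_norm]
  let h : EuclideanSpace ℝ (Fin d) → ℝ≥0∞ :=
    fun x => ENNReal.ofReal ((1 - θ x) * ‖fderiv ℝ f x‖ ^ 2)
  have hm : Measurable fun x => ENNReal.ofReal (θ x * ‖fderiv ℝ f x‖ ^ 2) :=
    (hθm.mul (by fun_prop : Continuous fun x => ‖fderiv ℝ f x‖ ^ 2).measurable).ennreal_ofReal
  calc ∫⁻ x, ‖fderiv ℝ (smoothPolarize ε e c f) x‖ₑ ^ 2
      ≤ ∫⁻ x, (ENNReal.ofReal (θ x * ‖fderiv ℝ f x‖ ^ 2) + h (reflect e c x)) := by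
        refine lintegral_mono fun x => ?_
        have h1 := norm_fderiv_smoothPolarize_sq_le (c := c) he hε hf x
        dsimp only [h, θ]
        rw [hrw, polarizeWeight_reflect he, ← ENNReal.ofReal_add
          (mul_nonneg (hθ x).1 (sq_nonneg _)) (mul_nonneg (sub_nonneg.2 (hθ x).2) (sq_nonneg _))]
        exact ENNReal.ofReal_le_ofReal h1
    _ = ∫⁻ x, (ENNReal.ofReal (θ x * ‖fderiv ℝ f x‖ ^ 2) + h x) := by
        rw [lintegral_add_left hm, lintegral_add_left hm, lintegral_comp_reflect he h]
    _ = ∫⁻ x, ‖fderiv ℝ f x‖ₑ ^ 2 := by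
        refine lintegral_congr fun x => ?_
        dsimp only [h]
        rw [hrw, ← ENNReal.ofReal_add (mul_nonneg (hθ x).1 (sq_nonneg _))
          (mul_nonneg (sub_nonneg.2 (hθ x).2) (sq_nonneg _))]
        congr 1
        ring

theorem abs_smoothPolarize_sub_polarize_le (hε : 0 < ε) (f : EuclideanSpace ℝ (Fin d) → ℝ)
    (x : EuclideanSpace ℝ (Fin d)) : |smoothPolarize ε e c f x - polarize e c f x| ≤ ε := by
  have h1 : smoothPolarize ε e c f x - polarize e c f x = side e c x *
      (smoothAbs ε (f x - f (reflect e c x)) - |f x - f (reflect e c x)|) / 2 := by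
    rw [smoothPolarize, polarize]; ring
  rw [h1, abs_div, abs_mul, abs_side, one_mul, abs_two]
  linarith [abs_smoothAbs_sub_abs_le hε (f x - f (reflect e c x))]

/-- Outside a centred ball that contains the support of `f`, polarization towards the centre
gives zero. -/
theorem polarize_eq_zero (he : ‖e‖ = 1) (hc : 0 < c) {r : ℝ} (hf : ∀ x, 0 ≤ f x)
    (hfr : ∀ x, r ≤ ‖x‖ → f x = 0) {x : EuclideanSpace ℝ (Fin d)} (hx : r ≤ ‖x‖) :
    polarize e c f x = 0 := by
  rcases le_or_gt (depth e c x) 0 with h | h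
  · rw [polarize_of_nonpos h, hfr x hx, min_eq_left (hf _)]
  · rw [polarize_of_pos h, hfr x hx, hfr _ (hx.trans (norm_lt_norm_reflect he hc h).le), max_self]

/-- Truncating the smooth polarization of a non-negative test function on a centred ball gives a
test function on the same ball. -/
theorem smoothPos_smoothPolarize_mem {R : ℝ} (he : ‖e‖ = 1) (hc : 0 < c) (hε : 0 < ε)
    (hf : f ∈ realTest (Metric.ball (0 : EuclideanSpace ℝ (Fin d)) R)) (hf0 : ∀ x, 0 ≤ f x) :
    (fun x => smoothPos ε (smoothPolarize ε e c f x)) ∈ realTest (Metric.ball 0 R) := by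
  obtain ⟨r, hrR, hr⟩ := exists_lt_subset_ball (isClosed_tsupport f) hf.2.2
  have hfr : ∀ x, r ≤ ‖x‖ → f x = 0 := fun x hx =>
    image_eq_zero_of_notMem_tsupport fun h => by
      have := mem_ball_zero_iff.1 (hr h)
      linarith
  have hsub : Function.support (fun x => smoothPos ε (smoothPolarize ε e c f x)) ⊆
      Metric.closedBall 0 r := by
    intro x hx
    by_contra hxr
    have hxr' : r ≤ ‖x‖ := by
      rw [mem_closedBall_zero_iff, not_le] at hxr
      exact hxr.le
    refine hx (smoothPos_eq_zero hε ?_)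
    have := abs_smoothPolarize_sub_polarize_le (e := e) (c := c) hε f x
    rw [polarize_eq_zero he hc hf0 hfr hxr', sub_zero] at this
    exact le_of_abs_le this
  have hts := closure_minimal hsub Metric.isClosed_closedBall
  exact ⟨(contDiff_smoothPos ε).comp (contDiff_smoothPolarize hε hf.1),
    HasCompactSupport.of_support_subset_isCompact (isCompact_closedBall 0 r) hsub,
    hts.trans (Metric.closedBall_subset_ball hrR)⟩

end Smooth

theorem abs_polarize_sub_le (f u : EuclideanSpace ℝ (Fin d) → ℝ) (x : EuclideanSpace ℝ (Fin d)) :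
    |polarize e c f x - polarize e c u x| ≤
      |f x - u x| + |f (reflect e c x) - u (reflect e c x)| := by
  rcases le_or_gt (depth e c x) 0 with h | h
  · rw [polarize_of_nonpos h, polarize_of_nonpos h]
    exact (abs_min_sub_min_le_max _ _ _ _).trans (max_le_add_of_nonneg (abs_nonneg _)
      (abs_nonneg _))
  · rw [polarize_of_pos h, polarize_of_pos h]
    exact (abs_max_sub_max_le_max _ _ _ _).trans (max_le_add_of_nonneg (abs_nonneg _)
      (abs_nonneg _))

theorem eLpNorm_polarize_sub_le (he : ‖e‖ = 1) {f u : EuclideanSpace ℝ (Fin d) → ℝ}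
    (hf : Measurable f) (hu : Measurable u) :
    eLpNorm (fun x => polarize e c f x - polarize e c u x) 2 volume ≤
      2 * eLpNorm (fun x => f x - u x) 2 volume := by
  have hm : AEStronglyMeasurable (fun x => f x - u x) volume :=
    (hf.sub hu).aestronglyMeasurable
  have h1 : eLpNorm ((fun x => f x - u x) ∘ reflect e c) 2 volume =
      eLpNorm (fun x => f x - u x) 2 volume :=
    eLpNorm_comp_measurePreserving hm (measurePreserving_reflect he)
  calc eLpNorm (fun x => polarize e c f x - polarize e c u x) 2 volume
      ≤ eLpNorm ((fun x => ‖f x - u x‖) + fun x => ‖((fun x => f x - u x) ∘ reflect e c) x‖) 2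
          volume := by
        refine eLpNorm_mono fun x => ?_
        refine (abs_polarize_sub_le f u x).trans (le_abs_self _)
    _ ≤ _ := eLpNorm_add_le hm.norm
        ((hf.sub hu).comp measurable_reflect).aestronglyMeasurable.norm (by norm_num)
    _ = 2 * eLpNorm (fun x => f x - u x) 2 volume := by
        rw [eLpNorm_norm, eLpNorm_norm, h1, two_mul]

/-- Polarization towards the centre of a ball does not increase the relaxed gradient norm of
non-negative functions. -/
theorem GradNormLE.polarize (he : ‖e‖ = 1) (hc : 0 < c) {R : ℝ}
    {u : EuclideanSpace ℝ (Fin d) → ℝ} (hu : Measurable u) (hu0 : ∀ᵐ x, 0 ≤ u x) {C : ℝ≥0∞}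
    (h : GradNormLE (Metric.ball 0 R) u C) :
    GradNormLE (Metric.ball 0 R) (polarize e c u) C := by
  intro η hη
  have hη2 := (ENNReal.half_pos hη).ne'
  have hη4 := (ENNReal.half_pos hη2).ne'
  obtain ⟨f, hf, hf0, h1, h2⟩ := h.exists_nonneg Metric.isBounded_ball
    hu.aestronglyMeasurable hu0 hη4
  obtain ⟨δ, hδ, hsmall⟩ := exists_pos_forall_eLpNorm_le
    (Metric.isBounded_ball (x := (0 : EuclideanSpace ℝ (Fin d))) (r := R)) hη2
  have hε : 0 < δ / 3 := by positivity
  set ε := δ / 3 with hεδ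
  have hfm : Measurable f := (realTest.continuous hf).measurable
  have hF := smoothPos_smoothPolarize_mem he hc hε hf hf0
  have hfR : ∀ x, R ≤ ‖x‖ → f x = 0 := fun x hx => realTest.eq_zero hf (by simpa using hx)
  refine ⟨_, hF, ?_, ?_⟩
  · have h3 : eLpNorm (fun x => smoothPos ε (smoothPolarize ε e c f x) -
        CubicQuintic.polarize e c f x) 2 volume ≤ η / 2 := by
      refine hsmall _ (fun x => ?_) fun x hx => ?_
      · have h4 := abs_smoothPos_sub_max_le hε (smoothPolarize ε e c f x)
        have h5 := abs_max_sub_max_le_abs (smoothPolarize ε e c f x)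
          (CubicQuintic.polarize e c f x) 0
        rw [max_eq_left (polarize_nonneg (hf0 x) (hf0 _))] at h5
        have h6 := abs_smoothPolarize_sub_polarize_le (e := e) (c := c) hε f x
        refine (abs_sub_le _ (max (smoothPolarize ε e c f x) 0) _).trans ?_
        linarith
      · rw [realTest.eq_zero hF hx, polarize_eq_zero he hc hf0 hfR (by simpa using hx), sub_zero]
    have h4 : eLpNorm (fun x => CubicQuintic.polarize e c f x - CubicQuintic.polarize e c u x) 2
        volume ≤ η / 2 := by
      refine (eLpNorm_polarize_sub_le he hfm hu).trans ?_
      calc 2 * eLpNorm (fun x => f x - u x) 2 volume ≤ 2 * (η / 2 / 2) := by gcongr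
        _ = η / 2 := ENNReal.mul_div_cancel (by norm_num) (by norm_num)
    have hpf := measurable_polarize (e := e) (c := c) hfm
    have hpu := measurable_polarize (e := e) (c := c) hu
    calc eLpNorm (fun x => smoothPos ε (smoothPolarize ε e c f x) -
          CubicQuintic.polarize e c u x) 2 volume
        = eLpNorm ((fun x => smoothPos ε (smoothPolarize ε e c f x) -
            CubicQuintic.polarize e c f x) +
            fun x => CubicQuintic.polarize e c f x - CubicQuintic.polarize e c u x) 2 volume := by
          congr 1; ext x; simp
      _ ≤ _ := eLpNorm_add_le ((realTest.continuous hF).measurable.sub hpf).aestronglyMeasurable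
          (hpf.sub hpu).aestronglyMeasurable (by norm_num)
      _ ≤ η / 2 + η / 2 := add_le_add h3 h4
      _ = η := ENNReal.add_halves η
  · calc eLpNorm (fderiv ℝ fun x => smoothPos ε (smoothPolarize ε e c f x)) 2 volume
        ≤ eLpNorm (fderiv ℝ (smoothPolarize ε e c f)) 2 volume :=
          eLpNorm_mono fun x => norm_fderiv_smoothPos_comp_le _
            (((contDiff_smoothPolarize hε hf.1).differentiable (by simp)) x)
      _ ≤ eLpNorm (fderiv ℝ f) 2 volume := eLpNorm_fderiv_smoothPolarize_le he hε hf.1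
      _ ≤ C + η := h2.trans (by
          gcongr
          exact ENNReal.half_le_self.trans ENNReal.half_le_self)

theorem relaxedEnergy_polarize_le (he : ‖e‖ = 1) (hc : 0 < c) {R : ℝ}
    {u : EuclideanSpace ℝ (Fin d) → ℝ} (hu : Measurable u) (hu0 : ∀ᵐ x, 0 ≤ u x) :
    relaxedEnergy (Metric.ball 0 R) (polarize e c u) ≤ relaxedEnergy (Metric.ball 0 R) u := by
  rw [relaxedEnergy, relaxedEnergy, lintegral_comp_polarize he hu
    (F := fun t => ENNReal.ofReal (wellDensity t)) continuous_wellDensity.measurable.ennreal_ofReal]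
  have : gradNorm (Metric.ball 0 R) (polarize e c u) ≤ gradNorm (Metric.ball 0 R) u :=
    le_sInf fun C hC => sInf_le (GradNormLE.polarize he hc hu hu0 hC)
  gcongr

theorem eLpNorm_polarize (he : ‖e‖ = 1) {u : EuclideanSpace ℝ (Fin d) → ℝ} (hu : Measurable u) :
    eLpNorm (polarize e c u) 2 volume = eLpNorm u 2 volume := by
  have h : eLpNorm (polarize e c u) 2 volume ^ 2 = eLpNorm u 2 volume ^ 2 := by
    rw [eLpNorm_two_sq, eLpNorm_two_sq]
    exact lintegral_comp_polarize he hu (F := fun t => ‖t‖ₑ ^ 2) (by fun_prop)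
  exact le_antisymm ((ENNReal.pow_le_pow_left_iff two_ne_zero).1 h.le)
    ((ENNReal.pow_le_pow_left_iff two_ne_zero).1 h.ge)

end Polarization

/-! ### Radial monotonicity -/

section Monotonicity

variable {d : ℕ} {e : EuclideanSpace ℝ (Fin d)} {c : ℝ}

/-- Against a function that is odd under a reflection, only the odd part matters. -/
theorem two_mul_integral_mul_of_odd (he : ‖e‖ = 1) {w k : EuclideanSpace ℝ (Fin d) → ℝ}
    (hk : ∀ x, k (reflect e c x) = -k x) (hwk : Integrable (fun x => w x * k x) volume) :
    2 * ∫ x, w x * k x = ∫ x, (w x - w (reflect e c x)) * k x := by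
  have h1 : ∫ x, w x * k x = ∫ x, -(w (reflect e c x) * k x) := by
    rw [← integral_comp_reflect (c := c) he fun x => w x * k x]
    refine integral_congr_ae (Eventually.of_forall fun x => ?_)
    simp [hk]
  have h2 : Integrable (fun x => -(w (reflect e c x) * k x)) volume := by
    have := (measurePreserving_reflect (c := c) he).integrable_comp_of_integrable hwk
    refine this.congr (Eventually.of_forall fun x => ?_)
    simp [hk]
  rw [two_mul]
  nth_rewrite 2 [h1]
  rw [← integral_add hwk h2]
  refine integral_congr_ae (Eventually.of_forall fun x => ?_)
  dsimp only
  ring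

/-- A weight on the ball of radius `R` that is strictly decreasing in the distance from the
centre. -/
def radialWeight (R : ℝ) (x : EuclideanSpace ℝ (Fin d)) : ℝ := max (R ^ 2 - ‖x‖ ^ 2) 0

theorem memLp_radialWeight (R : ℝ) :
    MemLp (radialWeight R : EuclideanSpace ℝ (Fin d) → ℝ) 2 volume := by
  have hc : Continuous (radialWeight R : EuclideanSpace ℝ (Fin d) → ℝ) := by
    unfold radialWeight; fun_prop
  refine hc.memLp_of_hasCompactSupport ?_
  refine HasCompactSupport.intro (isCompact_closedBall 0 |R|) fun x hx => ?_
  rw [mem_closedBall_zero_iff, not_le] at hx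
  refine max_eq_right (sub_nonpos.2 ?_)
  rw [← sq_abs R]
  gcongr

/-- If polarization does not increase the integral against `radialWeight`, the function agrees with
its polarization: otherwise moving the larger values towards the centre increases the
integral. -/
theorem reflect_le_of_integral_le (he : ‖e‖ = 1) (hc : 0 < c) {R : ℝ}
    {u : EuclideanSpace ℝ (Fin d) → ℝ} (hu : Measurable u) (hu2 : MemLp u 2 volume)
    (hu0 : ∀ᵐ x, 0 ≤ u x) (huR : ∀ᵐ x, x ∉ Metric.ball (0 : EuclideanSpace ℝ (Fin d)) R → u x = 0)
    (h : ∫ x, radialWeight R x * polarize e c u x ≤ ∫ x, radialWeight R x * u x) :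
    ∀ᵐ x, 0 < depth e c x → u (reflect e c x) ≤ u x := by
  set w : EuclideanSpace ℝ (Fin d) → ℝ := radialWeight R with hw
  set k : EuclideanSpace ℝ (Fin d) → ℝ := fun x => polarize e c u x - u x with hkdef
  have hp2 : MemLp (polarize e c u) 2 volume :=
    ⟨(measurable_polarize hu).aestronglyMeasurable, by rw [eLpNorm_polarize he hu]; exact hu2.2⟩
  have hw2 : MemLp w 2 volume := memLp_radialWeight R
  have hk : ∀ x, k (reflect e c x) = -k x := by
    intro x
    rcases polarize_reflect (c := c) he u x with ⟨h1, h2⟩ | ⟨h1, h2⟩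
    · simp only [hkdef, h1, h2, sub_self, neg_zero]
    · simp only [hkdef, h1, h2]; ring
  have hwk : Integrable (fun x => w x * k x) volume := hw2.integrable_mul (hp2.sub hu2)
  have hint : ∫ x, w x * k x ≤ 0 := by
    have h1 : ∫ x, w x * k x = (∫ x, w x * polarize e c u x) - ∫ x, w x * u x := by
      rw [← integral_sub (by exact hw2.integrable_mul hp2) (by exact hw2.integrable_mul hu2)]
      refine integral_congr_ae (Eventually.of_forall fun x => ?_)
      simp only [hkdef]
      ring
    rw [h1]
    linarith
  have hwmono : ∀ x y : EuclideanSpace ℝ (Fin d), ‖x‖ ≤ ‖y‖ → w y ≤ w x := fun x y hxy => by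
    simp only [hw, radialWeight]
    gcongr
  have hpos : ∀ x, 0 ≤ (w x - w (reflect e c x)) * k x := by
    intro x
    rcases lt_trichotomy (depth e c x) 0 with hx | hx | hx
    · have h1 : ‖reflect e c x‖ < ‖x‖ := by
        have := norm_lt_norm_reflect (c := c) he hc (x := reflect e c x)
          (by rw [depth_reflect he]; linarith)
        rwa [reflect_reflect he] at this
      refine mul_nonneg_of_nonpos_of_nonpos (sub_nonpos.2 (hwmono _ _ h1.le)) ?_
      simp only [hkdef, polarize_of_nonpos hx.le, sub_nonpos, min_le_left]
    · rw [reflect_eq_self hx, sub_self, zero_mul]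
    · refine mul_nonneg (sub_nonneg.2 (hwmono _ _ (norm_lt_norm_reflect he hc hx).le)) ?_
      simp only [hkdef, polarize_of_pos hx, sub_nonneg, le_max_left]
  have hint2 : Integrable (fun x => (w x - w (reflect e c x)) * k x) volume :=
    (hw2.sub (hw2.comp_measurePreserving (measurePreserving_reflect he))).integrable_mul
      (hp2.sub hu2)
  have hzero : ∫ x, (w x - w (reflect e c x)) * k x = 0 := by
    refine le_antisymm ?_ (integral_nonneg hpos)
    rw [← two_mul_integral_mul_of_odd he hk hwk]
    linarith
  have hae := (integral_eq_zero_iff_of_nonneg hpos hint2).1 hzero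
  have huR' := (measurePreserving_reflect (c := c) he).quasiMeasurePreserving.ae huR
  filter_upwards [hae, hu0, huR'] with x hx hx0 hxR hdx
  have hlt := norm_lt_norm_reflect he hc hdx
  rcases lt_or_ge ‖x‖ R with hxR' | hxR'
  · have hwlt : w (reflect e c x) < w x := by
      simp only [hw, radialWeight]
      rw [max_eq_left (sub_nonneg.2 (pow_le_pow_left₀ (norm_nonneg x) hxR'.le 2))]
      refine max_lt ?_ (sub_pos.2 (pow_lt_pow_left₀ hxR' (norm_nonneg x) two_ne_zero))
      gcongr
    have hk0 : k x = 0 := by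
      rcases mul_eq_zero.1 hx with h1 | h1
      · exact absurd h1 (sub_pos.2 hwlt).ne'
      · exact h1
    simp only [hkdef, polarize_of_pos hdx, sub_eq_zero] at hk0
    exact max_eq_left_iff.1 hk0
  · rw [hxR (by simpa using hxR'.trans hlt.le)]
    exact hx0

/-- The average of `u` over the closed ball of radius `r` around `x`. -/
def closedBallAverage (r : ℝ) (u : EuclideanSpace ℝ (Fin d) → ℝ) (x : EuclideanSpace ℝ (Fin d)) :
    ℝ := ⨍ y in Metric.closedBall x r, u y

theorem closedBallAverage_eq (r : ℝ) (u : EuclideanSpace ℝ (Fin d) → ℝ)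
    (x : EuclideanSpace ℝ (Fin d)) :
    closedBallAverage r u x =
      (volume.real (Metric.closedBall (0 : EuclideanSpace ℝ (Fin d)) r))⁻¹ *
        ∫ y, u y * (Metric.closedBall x r).indicator 1 y := by
  rw [closedBallAverage, setAverage_eq, smul_eq_mul, Measure.real,
    Measure.addHaar_closedBall_center, ← Measure.real,
    ← integral_indicator Metric.isClosed_closedBall.measurableSet]
  congr 2
  ext y
  by_cases hy : y ∈ Metric.closedBall x r <;> simp [hy]

theorem integrable_mul_indicator {u : EuclideanSpace ℝ (Fin d) → ℝ} (hu : Integrable u volume)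
    (x : EuclideanSpace ℝ (Fin d)) (r : ℝ) :
    Integrable (fun y => u y * (Metric.closedBall x r).indicator 1 y) volume := by
  refine (hu.indicator (s := Metric.closedBall x r)
    Metric.isClosed_closedBall.measurableSet).congr (Eventually.of_forall fun y => ?_)
  by_cases hy : y ∈ Metric.closedBall x r <;> simp [hy]

theorem closedBallAverage_reflect_le (he : ‖e‖ = 1) {u : EuclideanSpace ℝ (Fin d) → ℝ}
    (hu : Integrable u volume) (h : ∀ᵐ x, 0 < depth e c x → u (reflect e c x) ≤ u x) (r : ℝ)
    {x : EuclideanSpace ℝ (Fin d)} (hx : 0 < depth e c x) :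
    closedBallAverage r u (reflect e c x) ≤ closedBallAverage r u x := by
  rw [closedBallAverage_eq, closedBallAverage_eq]
  refine mul_le_mul_of_nonneg_left ?_ (by positivity)
  set k : EuclideanSpace ℝ (Fin d) → ℝ := fun y =>
    (Metric.closedBall x r).indicator 1 y - (Metric.closedBall (reflect e c x) r).indicator 1 y
    with hk
  have hmem : ∀ y z : EuclideanSpace ℝ (Fin d),
      reflect e c y ∈ Metric.closedBall (reflect e c z) r ↔ y ∈ Metric.closedBall z r := by
    intro y z
    rw [Metric.mem_closedBall, Metric.mem_closedBall, dist_eq_norm, dist_eq_norm,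
      norm_reflect_sub_reflect he]
  have hodd : ∀ y, k (reflect e c y) = -k y := by
    intro y
    have h1 := hmem y x
    have h2 := hmem y (reflect e c x)
    rw [reflect_reflect he] at h2
    have i1 := indicator_eq_indicator (f := (1 : EuclideanSpace ℝ (Fin d) → ℝ))
      (g := (1 : EuclideanSpace ℝ (Fin d) → ℝ)) h1 rfl
    have i2 := indicator_eq_indicator (f := (1 : EuclideanSpace ℝ (Fin d) → ℝ))
      (g := (1 : EuclideanSpace ℝ (Fin d) → ℝ)) h2 rfl
    simp only [hk, i1, i2, neg_sub]
  have hint : Integrable (fun y => u y * k y) volume := by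
    simp only [hk, mul_sub]
    exact (integrable_mul_indicator hu _ _).sub (integrable_mul_indicator hu _ _)
  have hkpos : ∀ y, 0 ≤ depth e c y → 0 ≤ k y := by
    intro y hy
    have : y ∈ Metric.closedBall (reflect e c x) r → y ∈ Metric.closedBall x r := by
      rw [Metric.mem_closedBall, Metric.mem_closedBall, dist_eq_norm, dist_eq_norm]
      intro h1
      refine le_trans ?_ h1
      refine le_of_sq_le_sq ?_ (norm_nonneg _)
      rw [norm_sub_reflect_sq he]
      have : 0 ≤ 4 * depth e c x * depth e c y := by positivity
      linarith
    refine sub_nonneg.2 ?_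
    by_cases hb : y ∈ Metric.closedBall (reflect e c x) r
    · rw [indicator_of_mem hb, indicator_of_mem (this hb)]
    · rw [indicator_of_notMem hb]
      exact indicator_nonneg (fun _ _ => zero_le_one) y
  have hpos : 0 ≤ ∫ y, (u y - u (reflect e c y)) * k y := by
    refine integral_nonneg_of_ae ?_
    filter_upwards [h, (measurePreserving_reflect (c := c) he).quasiMeasurePreserving.ae h]
      with y h1 h2
    rw [reflect_reflect he, depth_reflect he] at h2
    rcases lt_trichotomy (depth e c y) 0 with hy | hy | hy
    · refine mul_nonneg_of_nonpos_of_nonpos (sub_nonpos.2 (h2 (by linarith))) ?_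
      have := hkpos (reflect e c y) (by rw [depth_reflect he]; linarith)
      rw [hodd] at this
      linarith
    · simp [reflect_eq_self hy]
    · exact mul_nonneg (sub_nonneg.2 (h1 hy)) (hkpos y hy.le)
  rw [← two_mul_integral_mul_of_odd he hodd hint] at hpos
  simp only [hk, mul_sub] at hpos
  rw [integral_sub (integrable_mul_indicator hu _ _) (integrable_mul_indicator hu _ _)] at hpos
  linarith

theorem continuous_closedBallAverage {u : EuclideanSpace ℝ (Fin d) → ℝ}
    (hu : Integrable u volume) {r : ℝ} (hr : r ≠ 0) : Continuous (closedBallAverage r u) := by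
  have h0 : closedBallAverage r u = fun x =>
      (volume.real (Metric.closedBall (0 : EuclideanSpace ℝ (Fin d)) r))⁻¹ *
        ∫ y, u y * (Metric.closedBall x r).indicator 1 y := funext (closedBallAverage_eq r u)
  rw [h0]
  refine continuous_const.mul (continuous_iff_continuousAt.2 fun x => ?_)
  refine continuousAt_of_dominated (bound := fun y => ‖u y‖)
    (Eventually.of_forall fun z => (integrable_mul_indicator hu z r).1)
    (Eventually.of_forall fun z => Eventually.of_forall fun y => ?_) hu.norm ?_
  · by_cases hy : y ∈ Metric.closedBall z r <;> simp [hy]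
  · have hs : ∀ᵐ y, y ∉ Metric.sphere x r :=
      measure_eq_zero_iff_ae_notMem.1 (Measure.addHaar_sphere_of_ne_zero volume x hr)
    filter_upwards [hs] with y hy
    refine continuousAt_const.mul ?_
    rcases lt_or_gt_of_ne (show dist y x ≠ r from hy) with h | h
    · refine continuousAt_const.congr (f := fun _ => (1 : ℝ)) ?_
      have hc : ContinuousAt (fun z => dist y z) x := by fun_prop
      filter_upwards [hc.eventually_lt_const h] with z hz
      rw [indicator_of_mem (Metric.mem_closedBall.2 hz.le), Pi.one_apply]
    · refine continuousAt_const.congr (f := fun _ => (0 : ℝ)) ?_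
      have hc : ContinuousAt (fun z => dist y z) x := by fun_prop
      filter_upwards [hc.eventually_const_lt h] with z hz
      rw [indicator_of_notMem fun h' => hz.not_ge (Metric.mem_closedBall.1 h')]

/-- A function that agrees with its polarizations at all mirrors off the origin has radially
decreasing averages. -/
theorem closedBallAverage_anti {u : EuclideanSpace ℝ (Fin d) → ℝ} (hu : Integrable u volume)
    (h : ∀ (e : EuclideanSpace ℝ (Fin d)) (c : ℝ), ‖e‖ = 1 → 0 < c →
      ∀ᵐ x, 0 < depth e c x → u (reflect e c x) ≤ u x)
    {r : ℝ} (hr : r ≠ 0) {x y : EuclideanSpace ℝ (Fin d)} (hy : 0 < ‖y‖) (hxy : ‖x‖ ≤ ‖y‖) :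
    closedBallAverage r u y ≤ closedBallAverage r u x := by
  have hlt : ∀ z : EuclideanSpace ℝ (Fin d), ‖x‖ < ‖z‖ →
      closedBallAverage r u z ≤ closedBallAverage r u x := by
    intro z hz
    -- The mirror is the perpendicular bisector of `x` and `z`.
    have hzx : z - x ≠ 0 := fun h0 => hz.ne (by rw [sub_eq_zero.1 h0])
    have hn : 0 < ‖z - x‖ := norm_pos_iff.2 hzx
    set e : EuclideanSpace ℝ (Fin d) := ‖z - x‖⁻¹ • (z - x) with he
    set c : ℝ := ‖z - x‖⁻¹ * ((‖z‖ ^ 2 - ‖x‖ ^ 2) / 2) with hcdef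
    have he1 : ‖e‖ = 1 := norm_smul_inv_norm hzx
    have hc : 0 < c := by
      have : ‖x‖ ^ 2 < ‖z‖ ^ 2 := by gcongr
      refine mul_pos (inv_pos.2 hn) ?_
      linarith
    have hdepth : depth e c x = ‖z - x‖ / 2 := by
      have h1 : inner ℝ (z - x) x = inner ℝ z x - ‖x‖ ^ 2 := by
        rw [inner_sub_left, real_inner_self_eq_norm_sq]
      have h2 := norm_sub_sq_real z x
      rw [depth, he, real_inner_smul_left, h1, hcdef, ← mul_sub]
      field_simp
      linarith
    have hrefl : reflect e c x = z := by
      rw [reflect, hdepth, he, smul_smul, mul_div_cancel₀ _ two_ne_zero,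
        mul_inv_cancel₀ hn.ne', one_smul, add_sub_cancel]
    rw [← hrefl]
    exact closedBallAverage_reflect_le he1 hu (h e c he1 hc) r (by rw [hdepth]; positivity)
  have hcont : Tendsto (fun t : ℝ => closedBallAverage r u (t • y)) (𝓝[>] 1)
      (𝓝 (closedBallAverage r u y)) := by
    have h1 : Continuous fun t : ℝ => closedBallAverage r u (t • y) :=
      (continuous_closedBallAverage hu hr).comp (by fun_prop)
    have h2 := h1.tendsto 1
    rw [one_smul] at h2
    exact h2.mono_left nhdsWithin_le_nhds
  refine le_of_tendsto hcont ?_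
  filter_upwards [self_mem_nhdsWithin] with t ht
  refine hlt _ ?_
  rw [norm_smul, Real.norm_of_nonneg (by linarith [mem_Ioi.1 ht])]
  have : 1 * ‖y‖ < t * ‖y‖ := by gcongr; exact ht
  linarith

/-- A non-negative function that agrees with its polarizations at all mirrors off the origin has a
radially decreasing representative: the upper limit of its averages over small balls. -/
theorem exists_radial_representative {u : EuclideanSpace ℝ (Fin d) → ℝ} (hu : Integrable u volume)
    (hu0 : ∀ᵐ x, 0 ≤ u x)
    (h : ∀ (e : EuclideanSpace ℝ (Fin d)) (c : ℝ), ‖e‖ = 1 → 0 < c →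
      ∀ᵐ x, 0 < depth e c x → u (reflect e c x) ≤ u x) :
    ∃ v : EuclideanSpace ℝ (Fin d) → ℝ, v =ᵐ[volume] u ∧ (∀ x, 0 ≤ v x) ∧
      ∀ D, IsRadialDecreasingOn D v := by
  let r : ℕ → ℝ := fun n => 1 / ((n : ℝ) + 1)
  have hr : ∀ n, r n ≠ 0 := fun n => by positivity
  have hr0 : Tendsto r atTop (𝓝[>] 0) :=
    tendsto_nhdsWithin_iff.2 ⟨tendsto_one_div_add_atTop_nhds_zero_nat,
      Eventually.of_forall fun n => by simp only [r, mem_Ioi]; positivity⟩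
  -- The upper limit is taken in `[0, ∞]`, where it always exists; it is finite off the origin.
  let V : EuclideanSpace ℝ (Fin d) → ℝ≥0∞ :=
    fun x => limsup (fun n => ENNReal.ofReal (closedBallAverage (r n) u x)) atTop
  have hV : ∀ᵐ x, V x = ENNReal.ofReal (u x) := by
    filter_upwards [IsUnifLocDoublingMeasure.ae_tendsto_average volume hu.locallyIntegrable 1]
      with x hx
    have h1 := hx (l := atTop) (fun _ => x) r hr0 (Eventually.of_forall fun n => by
      rw [one_mul]
      exact Metric.mem_closedBall_self (by positivity))
    exact ((ENNReal.continuous_ofReal.tendsto _).comp h1).limsup_eq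
  have hmono : ∀ x y : EuclideanSpace ℝ (Fin d), 0 < ‖y‖ → ‖x‖ ≤ ‖y‖ → V y ≤ V x := by
    intro x y hy hxy
    exact limsup_le_limsup (Eventually.of_forall fun n =>
      ENNReal.ofReal_le_ofReal (closedBallAverage_anti hu h (hr n) hy hxy))
  have hfin : ∀ x : EuclideanSpace ℝ (Fin d), 0 < ‖x‖ → V x ≠ ⊤ := by
    intro x hx htop
    let U : Set (EuclideanSpace ℝ (Fin d)) := {y | 0 < ‖y‖ ∧ ‖y‖ < ‖x‖}
    have hUo : IsOpen U := (isOpen_lt continuous_const continuous_norm).inter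
      (isOpen_lt continuous_norm continuous_const)
    have hUn : U.Nonempty := by
      refine ⟨(1 / 2 : ℝ) • x, ?_⟩
      have h2 : ‖(1 / 2 : ℝ) • x‖ = ‖x‖ / 2 := by
        rw [norm_smul, Real.norm_of_nonneg (by norm_num)]; ring
      exact ⟨by rw [h2]; positivity, by rw [h2]; linarith⟩
    have hUtop : ∀ y ∈ U, V y = ⊤ := fun y hy => top_le_iff.1 (htop ▸ hmono y x hx hy.2.le)
    have hnull : volume U = 0 := by
      refine measure_mono_null (fun y hy => ?_) hV
      simp [hUtop y hy]
    exact (hUo.measure_pos volume hUn).ne' hnull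
  have hle : ∀ x y : EuclideanSpace ℝ (Fin d), 0 < ‖x‖ → ‖x‖ ≤ ‖y‖ →
      (V y).toReal ≤ (V x).toReal := fun x y hx hxy =>
    ENNReal.toReal_mono (hfin x hx) (hmono x y (hx.trans_le hxy) hxy)
  refine ⟨fun x => (V x).toReal, ?_, fun x => ENNReal.toReal_nonneg, fun D => ⟨?_, ?_⟩⟩
  · filter_upwards [hV, hu0] with x hx hx0
    rw [hx, ENNReal.toReal_ofReal hx0]
  · intro x _ y _ hxy
    rcases (norm_nonneg x).eq_or_lt with h0 | h0
    · rw [norm_eq_zero.1 h0.symm, norm_eq_zero.1 (hxy.symm.trans h0.symm)]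
    · exact le_antisymm (hle y x (hxy ▸ h0) hxy.ge) (hle x y h0 hxy.le)
  · exact fun x _ y _ hx hxy => hle x y hx hxy

end Monotonicity

/-! ### Ground states -/

section GroundStates

variable {d : ℕ} {D : Set (EuclideanSpace ℝ (Fin d))}

theorem isGroundState_of_ae_eq (hd1 : 1 ≤ d) (hd3 : d ≤ 3) (hDo : IsOpen D)
    (hD : Bornology.IsBounded D) {N : ℝ} (hN : 0 ≤ N)
    {u : Lp ℝ 2 (volume : Measure (EuclideanSpace ℝ (Fin d)))} (hun : ‖u‖ = √N)
    (hfin : relaxedEnergy D u ≠ ⊤)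
    (hmin : ∀ v : Lp ℝ 2 (volume : Measure (EuclideanSpace ℝ (Fin d))), 0 ≤ v → ‖v‖ = √N →
      relaxedEnergy D u ≤ relaxedEnergy D v)
    {v : EuclideanSpace ℝ (Fin d) → ℝ} (hv : v =ᵐ[volume] u) :
    IsGroundState D N fun x => (v x : ℂ) := by
  have hvm : MemLp v 2 volume := (memLp_congr_ae hv).2 (Lp.memLp u)
  refine isGroundState_of_minimizer hd1 hd3 hDo hD hN hvm ?_ ?_ ?_
  · rw [Lp.norm_toLp, eLpNorm_congr_ae hv, ← Lp.norm_def, hun]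
  · rwa [relaxedEnergy_congr_ae hv]
  · rwa [relaxedEnergy_congr_ae hv]

theorem exists_nonneg_groundState (hd1 : 1 ≤ d) (hd3 : d ≤ 3) (hDo : IsOpen D) (hDn : D.Nonempty)
    (hD : Bornology.IsBounded D) {N : ℝ} (hN : 0 < N) :
    ∃ u : EuclideanSpace ℝ (Fin d) → ℝ, (∀ x ∈ D, 0 ≤ u x) ∧
      IsGroundState D N fun x => (u x : ℂ) := by
  obtain ⟨v₀, h0, hn, hfin⟩ := exists_competitor hDo hDn hN
  obtain ⟨u, hu0, hun, hufin, hmin⟩ := exists_minimizer hD 0 h0 hn hfin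
  refine ⟨fun x => |u x|, fun x _ => abs_nonneg _,
    isGroundState_of_ae_eq hd1 hd3 hDo hD hN.le hun hufin (fun v hv hvn => (hmin v hv hvn).1) ?_⟩
  filter_upwards [(Lp.coeFn_nonneg u).2 hu0] with x hx
  exact abs_of_nonneg hx

theorem exists_radial_groundState (hd1 : 1 ≤ d) (hd3 : d ≤ 3) {R : ℝ} (hR : 0 < R) {N : ℝ}
    (hN : 0 < N) :
    ∃ u : EuclideanSpace ℝ (Fin d) → ℝ, (∀ x ∈ Metric.ball 0 R, 0 ≤ u x) ∧
      IsRadialDecreasingOn (Metric.ball 0 R) u ∧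
      IsGroundState (Metric.ball 0 R) N fun x => (u x : ℂ) := by
  have hD : Bornology.IsBounded (Metric.ball (0 : EuclideanSpace ℝ (Fin d)) R) :=
    Metric.isBounded_ball
  obtain ⟨v₀, h0, hn, hfin⟩ := exists_competitor (d := d) Metric.isOpen_ball
    (Metric.nonempty_ball.2 hR) hN
  have hw := memLp_radialWeight (d := d) R
  obtain ⟨u, hu0, hun, hufin, hmin⟩ := exists_minimizer hD hw.toLp h0 hn hfin
  have hum : Measurable u := (Lp.stronglyMeasurable u).measurable
  have hu2 : MemLp u 2 volume := Lp.memLp u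
  have hu0' : ∀ᵐ x, 0 ≤ u x := (Lp.coeFn_nonneg u).2 hu0
  have hgfin : gradNorm (Metric.ball 0 R) u ≠ ⊤ :=
    ne_top_of_le_ne_top (by finiteness) (gradNorm_le_of_relaxedEnergy_le le_rfl)
  have huR := ((gradNorm_le_iff hgfin).1 le_rfl).ae_eq_zero hu2.1
  have hu1 : Integrable u volume := by
    have : IsFiniteMeasure (volume.restrict (Metric.ball (0 : EuclideanSpace ℝ (Fin d)) R)) :=
      ⟨by simpa using hD.measure_lt_top⟩
    have h1 : IntegrableOn u (Metric.ball 0 R) volume := (hu2.restrict _).integrable (by norm_num)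
    exact h1.integrable_of_ae_notMem_eq_zero huR
  have hsymm : ∀ (e : EuclideanSpace ℝ (Fin d)) (c : ℝ), ‖e‖ = 1 → 0 < c →
      ∀ᵐ x, 0 < depth e c x → u (reflect e c x) ≤ u x := by
    intro e c he hc
    refine reflect_le_of_integral_le he hc hum hu2 hu0' huR ?_
    have hp2 : MemLp (polarize e c u) 2 volume :=
      ⟨(measurable_polarize hum).aestronglyMeasurable,
        by rw [eLpNorm_polarize he hum]; exact hu2.2⟩
    have hrefl0 := (measurePreserving_reflect (c := c) he).quasiMeasurePreserving.ae hu0'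
    have h1 := (hmin hp2.toLp (by
      rw [← Lp.coeFn_nonneg]
      filter_upwards [hp2.coeFn_toLp, hu0', hrefl0] with x hx hx0 hx0'
      rw [hx]
      exact polarize_nonneg hx0 hx0') (by
      rw [Lp.norm_toLp, eLpNorm_polarize he hum, ← Lp.norm_def, hun])).2 (by
      rw [relaxedEnergy_congr_ae hp2.coeFn_toLp]
      exact relaxedEnergy_polarize_le he hc hum hu0')
    have hinner : ∀ {g : EuclideanSpace ℝ (Fin d) → ℝ}
        {G : Lp ℝ 2 (volume : Measure (EuclideanSpace ℝ (Fin d)))}, G =ᵐ[volume] g →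
        inner ℝ hw.toLp G = ∫ x, radialWeight R x * g x := by
      intro g G hG
      rw [L2.inner_def]
      refine integral_congr_ae ?_
      filter_upwards [hw.coeFn_toLp, hG] with x hx hx'
      rw [hx, hx']
      simp [mul_comm]
    rwa [hinner hp2.coeFn_toLp, hinner (EventuallyEq.refl _ _)] at h1
  obtain ⟨v, hvu, hv0, hv⟩ := exists_radial_representative hu1 hu0' hsymm
  exact ⟨v, fun x _ => hv0 x, hv _, isGroundState_of_ae_eq hd1 hd3 Metric.isOpen_ball hD hN.le hun
    hufin (fun v hv hvn => (hmin v hv hvn).1) hvu⟩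

end GroundStates

end CubicQuintic

end

theorem theorem1p1 (d : ℕ) (hd1 : 1 ≤ d) (hd3 : d ≤ 3)
    (D : Set (EuclideanSpace ℝ (Fin d))) (hDo : IsOpen D) (hDc : IsConnected D)
    (hDb : Bornology.IsBounded D) (N : ℝ) (hN : 0 < N) :
    (∃ u : EuclideanSpace ℝ (Fin d) → ℝ, (∀ x ∈ D, 0 ≤ u x) ∧
      CubicQuintic.IsGroundState D N (fun x => (u x : ℂ))) ∧
    ((∃ R : ℝ, 0 < R ∧ D = Metric.ball 0 R) →
      ∃ u : EuclideanSpace ℝ (Fin d) → ℝ, (∀ x ∈ D, 0 ≤ u x) ∧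
        CubicQuintic.IsRadialDecreasingOn D u ∧
        CubicQuintic.IsGroundState D N (fun x => (u x : ℂ))) := by
  refine ⟨CubicQuintic.exists_nonneg_groundState hd1 hd3 hDo hDc.nonempty hDb hN, ?_⟩
  rintro ⟨R, hR, rfl⟩
  exact CubicQuintic.exists_radial_groundState hd1 hd3 hR hN
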